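/- Let $(M,\xi)$ be a contact 3-manifold, i.e. $M$ is a smooth 3-manifold and $\xi=\ker\alpha$ for a contact form $\alpha$ (a smooth 1-form with $\alpha\wedge d\alpha$ nowhere zero), and let $X_\alpha$ be its Reeb vector field ($\alpha(X_\alpha)=1$, $d\alpha(X_\alpha,\cdot)=0$). Let $g$ be a Riemannian metric on $M$ compatible with $\xi$ through $\alpha$, i.e. $$g(u,v)=\frac1{\theta'}\,d\alpha(u,Jv)+\alpha(u)\alpha(v)\qquad(u,v\in TM)$$ where $\theta'>0$ is a constant (the instantaneous rotation) and $J$ is a complex structure on $\xi$, extended to $TM$ by $JX_\alpha=0$. Let $\nabla$ be the Levi-Civita connection of $g$, $R(u,v)w=\nabla_u\nabla_vw-\nabla_v\nabla_uw-\nabla_{[u,v]}w$ its curvature tensor, $k(u,v)$ the sectional curvature of the plane spanned by $u,v$, and $\mathrm{Ricci}(X_\alpha)$ the Ricci curvature of $X_\alpha$ (the trace of $u\mapsto R(u,X_\alpha)X_\alpha$). An $\alpha$-Jacobi field is a vector field $v(t)$ along a flow line of $X_\alpha$ with $\nabla_{X_\alpha}\nabla_{X_\alpha}v+R(v,X_\alpha)X_\alpha=0$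 and $\nabla_{X_\alpha}v=\nabla_vX_\alpha$. For $u,v\in\xi$ let $\mathbb{II}(u,v)=g(\nabla_uv,n)$ be the second fundamental form of $\xi$ with respect to a unit normal $n$ of $\xi$ (where $v$ is extended to a local section of $\xi$), and let $G(\xi)=\det\mathbb{II}$ be the extrinsic curvature of $\xi$. Then, at every point $p\in M$: 1. For every unit vector $e\in\xi_p$ there is a unique (germ at $t=0$ of an) $\alpha$-Jacobi field $\tilde e(t)$ along the flow line of $X_\alpha$ through $p$ with $\tilde e(0)=e$, and, with $e(t)=\tilde e(t)/|\tilde e(t)|$, the derivative below exists and $$k(e,X_\alpha)=g(Je,\nabla_eX_\alpha)^2-g(e,\nabla_eX_\alpha)^2-\frac{\partial}{\partial t}g\big(e(t),\nabla_{e(t)}X_\alpha\big)\Big|_{t=0}.$$ 2. For every unit vector $e\in\xi_p$, $\mathrm{Ricci}(X_\alpha)=k(e,X_\alpha)+k(Je,X_\alpha)$; moreover $\mathrm{Ricci}(X_\alpha)=2G(\xi)$. 3. For every smooth local unit section $e$ of $\xi$ near $p$ (so that $(e,Je,X_\alpha)$ is a local orthonormal frame), $$\mathrm{Ricci}(X_\alpha)(p)=-2P^2+\frac{\theta'^2}{2}-2Q^2,$$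 where, all evaluated at $p$, $$P=g(e,\nabla_eX_\alpha)=\frac1{\theta'}d\alpha([e,X_\alpha],Je),\qquad Q=\frac{\theta'}2-g(Je,\nabla_eX_\alpha)=\frac1{2\theta'}d\alpha([e,X_\alpha],e)-\frac1{2\theta'}d\alpha([Je,X_\alpha],Je).$$ 4. $\mathrm{Ricci}(X_\alpha)\le\theta'^2/2$. -/

import Mathlib

open Bundle FiberBundle VectorField
open scoped Manifold ContDiff Topology

noncomputable section Riem
variable {E : Type*} [NormedAddCommGroup E] [NormedSpace ℝ E] [FiniteDimensional ℝ E]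
  {H : Type*} [TopologicalSpace H] {I : ModelWithCorners ℝ E H}
  {M : Type*} [TopologicalSpace M] [ChartedSpace H M]

instance instFiniteDimensionalTangentSpace (x : M) : FiniteDimensional ℝ (TangentSpace I x) :=
  inferInstanceAs (FiniteDimensional ℝ E)

variable [RiemannianBundle (fun x : M ↦ TangentSpace I x)]

instance instCompleteSpaceTangentSpace (x : M) : CompleteSpace (TangentSpace I x) :=
  FiniteDimensional.complete ℝ (TangentSpace I x)

/-- The Koszul expression: for the Levi-Civita connection it equals `2 g(∇_X Y, Z)`. -/
def koszul (X Y Z : Π x : M, TangentSpace I x) (x : M) : ℝ :=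
  d% (fun y ↦ inner ℝ (Y y) (Z y)) x (X x) + d% (fun y ↦ inner ℝ (X y) (Z y)) x (Y x)
    - d% (fun y ↦ inner ℝ (X y) (Y y)) x (Z x)
    + inner ℝ (mlieBracket I X Y x) (Z x) - inner ℝ (mlieBracket I X Z x) (Y x)
    - inner ℝ (mlieBracket I Y Z x) (X x)

variable [IsManifold I ∞ M] [IsContMDiffRiemannianBundle I ∞ E (fun x : M ↦ TangentSpace I x)]

set_option linter.unusedSectionVars false in
theorem mdifferentiableAt_inner {x : M} {X Y : Π x : M, TangentSpace I x}
    (hX : MDiffAt (T% X) x) (hY : MDiffAt (T% Y) x) :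
    MDiffAt (fun y ↦ inner ℝ (X y) (Y y)) x :=
  MDifferentiableAt.inner_bundle (IB := I) (F := E) (E := fun x : M ↦ TangentSpace I x)
    (b := fun y ↦ y) hX hY

theorem koszul_tensorial_left {x : M} {Y : Π x : M, TangentSpace I x} (hY : MDiffAt (T% Y) x)
    (Z : Π x : M, TangentSpace I x) (hZ : MDiffAt (T% Z) x) :
    TensorialAt I E (fun X ↦ koszul X Y Z x) x where
  smul {f X} hf hX := by
    have : CompleteSpace E := FiniteDimensional.complete ℝ E
    have h1 := mvfderiv_fun_mul hf (mdifferentiableAt_inner hX hZ)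
    have h2 := mvfderiv_fun_mul hf (mdifferentiableAt_inner hX hY)
    simp only [koszul, Pi.smul_apply', mlieBracket_smul_left hf hX, real_inner_smul_left, h1, h2]
    simp [inner_add_left, real_inner_smul_left, real_inner_smul_right, real_inner_comm]
    ring
  add {X X'} hX hX' := by
    have : CompleteSpace E := FiniteDimensional.complete ℝ E
    have h1 := mvfderiv_fun_add (mdifferentiableAt_inner hX hZ) (mdifferentiableAt_inner hX' hZ)
    have h2 := mvfderiv_fun_add (mdifferentiableAt_inner hX hY) (mdifferentiableAt_inner hX' hY)
    simp only [koszul, Pi.add_apply, mlieBracket_add_left hX hX', inner_add_left, h1, h2]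
    simp [inner_add_right]
    ring

theorem koszul_tensorial_right {x : M} {Y : Π x : M, TangentSpace I x} (hY : MDiffAt (T% Y) x)
    (X : Π x : M, TangentSpace I x) (hX : MDiffAt (T% X) x) :
    TensorialAt I E (fun Z ↦ koszul X Y Z x) x where
  smul {f Z} hf hZ := by
    have : CompleteSpace E := FiniteDimensional.complete ℝ E
    have h1 := mvfderiv_fun_mul hf (mdifferentiableAt_inner hX hZ)
    have h2 := mvfderiv_fun_mul hf (mdifferentiableAt_inner hY hZ)
    simp only [koszul, Pi.smul_apply', mlieBracket_smul_right hf hZ, real_inner_smul_right, h1, h2]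
    simp [inner_add_left, real_inner_smul_right, real_inner_comm]
    ring
  add {Z Z'} hZ hZ' := by
    have : CompleteSpace E := FiniteDimensional.complete ℝ E
    have h1 := mvfderiv_fun_add (mdifferentiableAt_inner hX hZ) (mdifferentiableAt_inner hX hZ')
    have h2 := mvfderiv_fun_add (mdifferentiableAt_inner hY hZ) (mdifferentiableAt_inner hY hZ')
    simp only [koszul, Pi.add_apply, mlieBracket_add_right hZ hZ', inner_add_right, h1, h2]
    simp [inner_add_left]
    ring

open scoped Classical in
/-- The covariant derivative `v ↦ ∇_v Y` at `x`: the vector `∇_v Y` represents, through the metric,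
half of the Koszul form of `v` and `Y`. (The value is irrelevant where `Y` is not differentiable.) -/
def leviCivitaFun (Y : Π x : M, TangentSpace I x) (x : M) :
    TangentSpace I x →L[ℝ] TangentSpace I x :=
  if hY : MDiffAt (T% Y) x then
    (InnerProductSpace.toDual ℝ (TangentSpace I x)).symm.toContinuousLinearEquiv.toContinuousLinearMap ∘L
      ((2 : ℝ)⁻¹ • TensorialAt.mkHom₂ (fun X Z ↦ koszul X Y Z x) x
        (koszul_tensorial_left hY) (koszul_tensorial_right hY))
  else 0

theorem inner_leviCivitaFun {x : M} {X Y Z : Π x : M, TangentSpace I x} (hX : MDiffAt (T% X) x)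
    (hY : MDiffAt (T% Y) x) (hZ : MDiffAt (T% Z) x) :
    inner ℝ (leviCivitaFun Y x (X x)) (Z x) = 2⁻¹ * koszul X Y Z x := by
  rw [leviCivitaFun, dif_pos hY, ← TensorialAt.mkHom₂_apply (koszul_tensorial_left hY)
    (koszul_tensorial_right hY) hX hZ]
  simp [real_inner_smul_left]

theorem leviCivitaFun_ext {x : M} {Y : Π x : M, TangentSpace I x} (hY : MDiffAt (T% Y) x)
    {A : TangentSpace I x →L[ℝ] TangentSpace I x}
    (h : ∀ X Z : Π x : M, TangentSpace I x, MDiffAt (T% X) x → MDiffAt (T% Z) x →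
      inner ℝ (A (X x)) (Z x) = 2⁻¹ * koszul X Y Z x) : leviCivitaFun Y x = A := by
  ext v
  refine ext_inner_right ℝ fun z ↦ ?_
  have hv := mdifferentiableAt_extend I E v
  have hz := mdifferentiableAt_extend I E z
  have h1 := inner_leviCivitaFun hv hY hz
  have h2 := h _ _ hv hz
  simp only [extend_apply_self] at h1 h2
  rw [h1, h2]

theorem isCovariantDerivativeOn_leviCivitaFun :
    IsCovariantDerivativeOn E (leviCivitaFun (I := I) (M := M)) where
  add {Y Y' x} hY hY' _ := by
    refine leviCivitaFun_ext (mdifferentiableAt_add_section hY hY') fun X Z hX hZ ↦ ?_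
    have : CompleteSpace E := FiniteDimensional.complete ℝ E
    have h1 := mvfderiv_fun_add (mdifferentiableAt_inner hY hZ) (mdifferentiableAt_inner hY' hZ)
    have h2 := mvfderiv_fun_add (mdifferentiableAt_inner hX hY) (mdifferentiableAt_inner hX hY')
    rw [add_apply, inner_add_left, inner_leviCivitaFun hX hY hZ,
      inner_leviCivitaFun hX hY' hZ]
    simp only [koszul, Pi.add_apply, mlieBracket_add_right hY hY', mlieBracket_add_left hY hY',
      inner_add_right, inner_add_left, h1, h2]
    simp
    ring
  leibniz {Y f x} hY hf _ := by
    refine leviCivitaFun_ext (hf.smul_section hY) fun X Z hX hZ ↦ ?_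
    have : CompleteSpace E := FiniteDimensional.complete ℝ E
    have h1 := mvfderiv_fun_mul hf (mdifferentiableAt_inner hY hZ)
    have h2 := mvfderiv_fun_mul hf (mdifferentiableAt_inner hX hY)
    simp only [add_apply, smul_apply, inner_add_left,
      real_inner_smul_left, inner_leviCivitaFun hX hY hZ, ContinuousLinearMap.smulRight_apply]
    simp only [koszul, Pi.smul_apply', mlieBracket_smul_right hf hY, mlieBracket_smul_left hf hY,
      real_inner_smul_right, real_inner_smul_left, inner_add_left, h1, h2]
    simp [real_inner_comm]
    ring

variable (I M) in
/-- The Levi-Civita connection of the Riemannian metric. -/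
def leviCivita : CovariantDerivative I E (TangentSpace I : M → Type _) where
  toFun := leviCivitaFun
  isCovariantDerivativeOnUniv := isCovariantDerivativeOn_leviCivitaFun

theorem leviCivita_torsion : (leviCivita I M).torsion = 0 := by
  have : CompleteSpace E := FiniteDimensional.complete ℝ E
  rw [CovariantDerivative.torsion_eq_zero_iff]
  intro X Y x hX hY
  refine ext_inner_right ℝ fun z ↦ ?_
  have hz := mdifferentiableAt_extend I E z
  have h1 := inner_leviCivitaFun hX hY hz
  have h2 := inner_leviCivitaFun hY hX hz
  have h3 : mlieBracket I Y X x = - mlieBracket I X Y x := mlieBracket_swap_apply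
  have h4 : (fun y ↦ inner ℝ (Y y) (X y)) = fun y ↦ inner ℝ (X y) (Y y) :=
    funext fun y ↦ real_inner_comm _ _
  simp only [extend_apply_self, koszul] at h1 h2
  change inner ℝ (leviCivitaFun Y x (X x) - leviCivitaFun X x (Y x)) z = _
  rw [inner_sub_left, h1, h2, h3, h4]
  simp only [inner_neg_left]
  ring

theorem leviCivita_metric {x : M} {X Y Z : Π x : M, TangentSpace I x}
    (hX : MDiffAt (T% X) x) (hY : MDiffAt (T% Y) x) (hZ : MDiffAt (T% Z) x) :
    d% (fun y ↦ inner ℝ (Y y) (Z y)) x (X x)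
      = inner ℝ (leviCivita I M Y x (X x)) (Z x) + inner ℝ (Y x) (leviCivita I M Z x (X x)) := by
  have h1 := inner_leviCivitaFun hX hY hZ
  have h2 := inner_leviCivitaFun hX hZ hY
  have h3 : mlieBracket I Z Y x = - mlieBracket I Y Z x := mlieBracket_swap_apply
  change _ = inner ℝ (leviCivitaFun Y x (X x)) (Z x) + inner ℝ (Y x) (leviCivitaFun Z x (X x))
  rw [real_inner_comm (leviCivitaFun Z x (X x)), h1, h2]
  have h4 : (fun y ↦ inner ℝ (Z y) (Y y)) = fun y ↦ inner ℝ (Y y) (Z y) :=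
    funext fun y ↦ real_inner_comm _ _
  simp only [koszul, h3, h4, inner_neg_left]
  ring


/-- The Riemann curvature tensor `R(u, v)w = ∇_U ∇_V W - ∇_V ∇_U W - ∇_[U,V] W` at `x`, where
`U`, `V`, `W` are local smooth vector fields extending the tangent vectors `u`, `v`, `w`. -/
def riemannCurvature {x : M} (u v w : TangentSpace I x) : TangentSpace I x :=
  let U : Π y : M, TangentSpace I y := extend E u
  let V : Π y : M, TangentSpace I y := extend E v
  let W : Π y : M, TangentSpace I y := extend E w
  leviCivita I M (fun y ↦ leviCivita I M W y (V y)) x u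
    - leviCivita I M (fun y ↦ leviCivita I M W y (U y)) x v
    - leviCivita I M W x (mlieBracket I U V x)

/-- The sectional curvature `k(u, v)` of the plane spanned by `u` and `v`. -/
def sectionalCurvature {x : M} (u v : TangentSpace I x) : ℝ :=
  inner ℝ (riemannCurvature u v v) u / (‖u‖ ^ 2 * ‖v‖ ^ 2 - inner ℝ u v ^ 2)

/-- The Ricci curvature `Ric(v, v)`, the trace of `u ↦ R(u, v)v`. -/
def ricciCurvature {x : M} (v : TangentSpace I x) : ℝ :=
  ∑ i, inner ℝ (riemannCurvature (stdOrthonormalBasis ℝ (TangentSpace I x) i) v v)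
    (stdOrthonormalBasis ℝ (TangentSpace I x) i)

/-- The covariant derivative `D_t v` of a vector field `v` along the curve underlying `v`. In the
coordinates at the base point of `v t`, it is the derivative of the coordinate vector of `v`
plus the covariant derivative, in the direction of the velocity of the curve, of the vector field
with constant coordinates that extends `v t`. -/
def covariantDerivAlong (v : ℝ → TangentBundle I M) (t : ℝ) : TangentSpace I (v t).proj :=
  (trivializationAt E (TangentSpace I) (v t).proj).symm (v t).proj
      (deriv (fun s ↦ (trivializationAt E (TangentSpace I) (v t).proj (v s)).2) t)
    + leviCivita I M (extend E (v t).2) (v t).proj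
        (mfderiv 𝓘(ℝ, ℝ) I (fun s ↦ (v s).proj) t (1 : ℝ))

/-- For a vector field `X` with geodesic flow lines: `v` is a Jacobi field (defined for times near
`0`) along the flow line of `X` starting at the base point of `v 0`, and it comes from a variation
through flow lines of `X`, that is, `D_t v = ∇_v X`. For the Reeb vector field of a contact form
`α`, these are the `α`-Jacobi fields. -/
structure IsJacobiFieldOf (X : Π x : M, TangentSpace I x) (v : ℝ → TangentBundle I M) : Prop where
  isMIntegralCurveAt : IsMIntegralCurveAt (fun t ↦ (v t).proj) X 0
  contMDiffAt : ∀ᶠ t in 𝓝 0, ContMDiffAt 𝓘(ℝ, ℝ) I.tangent 2 v t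
  jacobi : ∀ᶠ t in 𝓝 0,
    covariantDerivAlong (fun s ↦ (⟨(v s).proj, covariantDerivAlong v s⟩ : TangentBundle I M)) t
      + riemannCurvature (v t).2 (X (v t).proj) (X (v t).proj) = 0
  deriv_eq : ∀ᶠ t in 𝓝 0, covariantDerivAlong v t = leviCivita I M X (v t).proj (v t).2

/-- The second fundamental form `II(u, v) = g(∇_u V, n)` at `x` of a plane field `ξ`, with respect
to a unit normal vector `n` at `x`; here `V` is the local section of `ξ` extending `v ∈ ξ x`
obtained by projecting a local extension of `v` orthogonally to `ξ`. -/
def secondFundamentalForm (ξ : Π x : M, Submodule ℝ (TangentSpace I x)) {x : M}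
    (n u v : TangentSpace I x) : ℝ :=
  let V : Π y : M, TangentSpace I y := fun y ↦ (ξ y).starProjection (extend E v y)
  inner ℝ (leviCivita I M V x u) n

/-- The extrinsic curvature `G(ξ) = det II` at `x`, computed in an orthonormal basis of `ξ x`. -/
def extrinsicCurvature (ξ : Π x : M, Submodule ℝ (TangentSpace I x)) {x : M}
    (n : TangentSpace I x) : ℝ :=
  let b := stdOrthonormalBasis ℝ (ξ x)
  Matrix.det (Matrix.of fun i j ↦ secondFundamentalForm ξ n (b i : TangentSpace I x) (b j))

end Riem

noncomputable section Contact
variable {E : Type*} [NormedAddCommGroup E] [NormedSpace ℝ E]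
  {H : Type*} [TopologicalSpace H] {I : ModelWithCorners ℝ E H}
  {M : Type*} [TopologicalSpace M] [ChartedSpace H M] [IsManifold I ∞ M]

/-- A 1-form is smooth if it is smooth as a section of the cotangent bundle. -/
def IsSmoothOneForm (α : Π x : M, TangentSpace I x →L[ℝ] ℝ) : Prop :=
  ContMDiff I (I.prod 𝓘(ℝ, E →L[ℝ] ℝ)) ∞ fun x ↦ TotalSpace.mk' (E →L[ℝ] ℝ)
    (E := fun x : M ↦ TangentSpace I x →L[ℝ] Bundle.Trivial M ℝ x) x (α x)

/-- A field of endomorphisms of the tangent spaces is smooth if it is smooth as a section of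
`Hom(TM, TM)`. -/
def IsSmoothEndomorphism (J : Π x : M, TangentSpace I x →L[ℝ] TangentSpace I x) : Prop :=
  ContMDiff I (I.prod 𝓘(ℝ, E →L[ℝ] E)) ∞ fun x ↦ TotalSpace.mk' (E →L[ℝ] E)
    (E := fun x : M ↦ TangentSpace I x →L[ℝ] TangentSpace I x) x (J x)

/-- The exterior derivative of a 1-form, by the invariant formula
`dα(u, v) = U(α(V)) - V(α(U)) - α([U, V])`, where `U`, `V` are local smooth vector fields extending
the tangent vectors `u`, `v` at `x`. -/
def extDerivOneForm (α : Π x : M, TangentSpace I x →L[ℝ] ℝ) {x : M} (u v : TangentSpace I x) : ℝ :=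
  let U : Π y : M, TangentSpace I y := extend E u
  let V : Π y : M, TangentSpace I y := extend E v
  d% (fun y ↦ α y (V y)) x u - d% (fun y ↦ α y (U y)) x v - α x (mlieBracket I U V x)

/-- The 3-form `α ∧ dα`. -/
def wedgeExtDeriv (α : Π x : M, TangentSpace I x →L[ℝ] ℝ) {x : M} (u v w : TangentSpace I x) : ℝ :=
  α x u * extDerivOneForm α v w - α x v * extDerivOneForm α u w + α x w * extDerivOneForm α u v

/-- A contact form on a 3-manifold: a smooth 1-form with `α ∧ dα` nowhere zero. -/
structure IsContactForm (α : Π x : M, TangentSpace I x →L[ℝ] ℝ) : Prop where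
  smooth : IsSmoothOneForm α
  contact : ∀ x : M, ∃ u v w : TangentSpace I x, wedgeExtDeriv α u v w ≠ 0

/-- The Reeb vector field of `α`: the vector field with `α(X) = 1` and `dα(X, ·) = 0`. -/
def reebField (α : Π x : M, TangentSpace I x →L[ℝ] ℝ) (x : M) : TangentSpace I x :=
  Classical.epsilon fun v : TangentSpace I x ↦ α x v = 1 ∧ ∀ w, extDerivOneForm α v w = 0

variable {α : Π x : M, TangentSpace I x →L[ℝ] ℝ}

theorem IsSmoothOneForm.mdifferentiableAt (hα : IsSmoothOneForm α) {x : M}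
    {V : Π x : M, TangentSpace I x} (hV : MDiffAt (T% V) x) : MDiffAt (fun y ↦ α y (V y)) x := by
  have h := (hα x).mdifferentiableAt (by simp)
  have := MDifferentiableAt.clm_bundle_apply (F₁ := E) (F₂ := ℝ) (E₁ := fun x : M ↦ TangentSpace I x)
    (E₂ := Bundle.Trivial M ℝ) (b := fun y : M ↦ y) (ϕ := α) (v := V) h hV
  rw [mdifferentiableAt_totalSpace] at this
  exact this.2

theorem extDerivOneForm_swap {x : M} (u v : TangentSpace I x) :
    extDerivOneForm α u v = - extDerivOneForm α v u := by
  simp only [extDerivOneForm]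
  rw [mlieBracket_swap_apply, map_neg]
  ring

variable [FiniteDimensional ℝ E]

theorem extDerivOneForm_tensorial_left (hα : IsSmoothOneForm α) {x : M}
    (V : Π x : M, TangentSpace I x) (_hV : MDiffAt (T% V) x) :
    TensorialAt I E (fun U : Π x : M, TangentSpace I x ↦ d% (fun y ↦ α y (V y)) x (U x)
      - d% (fun y ↦ α y (U y)) x (V x) - α x (mlieBracket I U V x)) x where
  smul {f U} hf hU := by
    have : CompleteSpace E := FiniteDimensional.complete ℝ E
    have h := mvfderiv_fun_mul hf (hα.mdifferentiableAt hU)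
    simp only [Pi.smul_apply', mlieBracket_smul_left hf hU, map_smul, map_add, smul_eq_mul, h]
    simp
    ring
  add {U U'} hU hU' := by
    have : CompleteSpace E := FiniteDimensional.complete ℝ E
    have h := mvfderiv_fun_add (hα.mdifferentiableAt hU) (hα.mdifferentiableAt hU')
    simp only [Pi.add_apply, mlieBracket_add_left hU hU', map_add, h]
    simp
    ring

theorem extDerivOneForm_tensorial_right (hα : IsSmoothOneForm α) {x : M}
    (U : Π x : M, TangentSpace I x) (_hU : MDiffAt (T% U) x) :
    TensorialAt I E (fun V : Π x : M, TangentSpace I x ↦ d% (fun y ↦ α y (V y)) x (U x)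
      - d% (fun y ↦ α y (U y)) x (V x) - α x (mlieBracket I U V x)) x where
  smul {f V} hf hV := by
    have : CompleteSpace E := FiniteDimensional.complete ℝ E
    have h := mvfderiv_fun_mul hf (hα.mdifferentiableAt hV)
    simp only [Pi.smul_apply', mlieBracket_smul_right hf hV, map_smul, map_add, smul_eq_mul, h]
    simp
    ring
  add {V V'} hV hV' := by
    have : CompleteSpace E := FiniteDimensional.complete ℝ E
    have h := mvfderiv_fun_add (hα.mdifferentiableAt hV) (hα.mdifferentiableAt hV')
    simp only [Pi.add_apply, mlieBracket_add_right hV hV', map_add, h]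
    simp
    ring

/-- The invariant formula for `dα` holds for all vector fields. -/
theorem extDerivOneForm_apply (hα : IsSmoothOneForm α) {x : M} {U V : Π x : M, TangentSpace I x}
    (hU : MDiffAt (T% U) x) (hV : MDiffAt (T% V) x) :
    extDerivOneForm α (U x) (V x) = d% (fun y ↦ α y (V y)) x (U x)
      - d% (fun y ↦ α y (U y)) x (V x) - α x (mlieBracket I U V x) := by
  rw [← TensorialAt.mkHom₂_apply (extDerivOneForm_tensorial_left hα)
    (extDerivOneForm_tensorial_right hα) hU hV, TensorialAt.mkHom₂_apply_eq_extend]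
  simp [extDerivOneForm]

theorem exists_bilin_extDerivOneForm (hα : IsSmoothOneForm α) (x : M) :
    ∃ B : TangentSpace I x →L[ℝ] TangentSpace I x →L[ℝ] ℝ,
      ∀ u v, extDerivOneForm α u v = B u v := by
  refine ⟨TensorialAt.mkHom₂ _ x (extDerivOneForm_tensorial_left hα)
    (extDerivOneForm_tensorial_right hα), fun u v ↦ ?_⟩
  rw [TensorialAt.mkHom₂_apply_eq_extend]
  simp [extDerivOneForm]

/-- On a 3-manifold, a contact form has exactly one Reeb vector at each point. -/
theorem existsUnique_reeb (hα : IsContactForm α) (hE : Module.finrank ℝ E = 3) (x : M) :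
    ∃! v : TangentSpace I x, α x v = 1 ∧ ∀ w, extDerivOneForm α v w = 0 := by
  obtain ⟨B, hB⟩ := exists_bilin_extDerivOneForm hα.smooth x
  have hsw : ∀ u v, B u v = - B v u := fun u v ↦ by rw [← hB, ← hB, extDerivOneForm_swap]
  have hself : ∀ u, B u u = 0 := fun u ↦ by linarith [hsw u u]
  obtain ⟨u₁, u₂, u₃, hD⟩ := hα.contact x
  simp only [wedgeExtDeriv, hB] at hD
  have key : ∀ c : Fin 3 → ℝ, α x (∑ i, c i • ![u₁, u₂, u₃] i) = 0 →
      (∀ w, B (∑ i, c i • ![u₁, u₂, u₃] i) w = 0) → ∀ i, c i = 0 := by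
    intro c h1 h2
    simp only [Fin.sum_univ_three, map_add, map_smul, add_apply, smul_apply, smul_eq_mul,
      Matrix.cons_val_zero, Matrix.cons_val_one, Matrix.cons_val] at h1 h2
    have e1 := h2 u₁
    have e2 := h2 u₂
    have e3 := h2 u₃
    rw [hself, hsw u₂ u₁, hsw u₃ u₁] at e1
    rw [hself, hsw u₃ u₂] at e2
    rw [hself] at e3
    have k1 : c 0 * (α x u₁ * B u₂ u₃ - α x u₂ * B u₁ u₃ + α x u₃ * B u₁ u₂) = 0 := by
      linear_combination B u₂ u₃ * h1 - α x u₂ * e3 + α x u₃ * e2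
    have k2 : c 1 * (α x u₁ * B u₂ u₃ - α x u₂ * B u₁ u₃ + α x u₃ * B u₁ u₂) = 0 := by
      linear_combination -B u₁ u₃ * h1 + α x u₁ * e3 - α x u₃ * e1
    have k3 : c 2 * (α x u₁ * B u₂ u₃ - α x u₂ * B u₁ u₃ + α x u₃ * B u₁ u₂) = 0 := by
      linear_combination B u₁ u₂ * h1 - α x u₁ * e2 + α x u₂ * e1
    intro i
    fin_cases i
    · exact (mul_eq_zero.1 k1).resolve_right hD
    · exact (mul_eq_zero.1 k2).resolve_right hD
    · exact (mul_eq_zero.1 k3).resolve_right hD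
  have hli : LinearIndependent ℝ ![u₁, u₂, u₃] := by
    rw [Fintype.linearIndependent_iff]
    intro c hc
    exact key c (by rw [hc, map_zero]) (fun w ↦ by rw [hc]; simp)
  let b : Module.Basis (Fin 3) ℝ (TangentSpace I x) :=
    basisOfLinearIndependentOfCardEqFinrank hli hE.symm
  have hb : ∀ w : TangentSpace I x, w = ∑ i, b.repr w i • ![u₁, u₂, u₃] i := fun w ↦ by
    conv_lhs => rw [← b.sum_repr w]
    exact Finset.sum_congr rfl fun i _ ↦ by
      rw [show b i = ![u₁, u₂, u₃] i from
        congrFun (coe_basisOfLinearIndependentOfCardEqFinrank hli hE.symm) i]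
  set D := α x u₁ * B u₂ u₃ - α x u₂ * B u₁ u₃ + α x u₃ * B u₁ u₂ with hDdef
  obtain ⟨v, h1, h2⟩ : ∃ v, α x v = 1 ∧ ∀ w, B v w = 0 := by
    refine ⟨D⁻¹ • (B u₂ u₃ • u₁ - B u₁ u₃ • u₂ + B u₁ u₂ • u₃), ?_, fun w ↦ ?_⟩
    · simp only [map_smul, map_add, map_sub, smul_eq_mul]
      rw [inv_mul_eq_iff_eq_mul₀ hD, hDdef]
      ring
    · rw [hb w]
      simp only [Fin.sum_univ_three, map_add, map_sub, map_smul, add_apply, sub_apply, smul_apply,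
        smul_eq_mul, Matrix.cons_val_zero, Matrix.cons_val_one, Matrix.cons_val, hself,
        hsw u₂ u₁, hsw u₃ u₁, hsw u₃ u₂]
      ring
  refine ⟨v, ⟨h1, fun w ↦ by rw [hB, h2]⟩, ?_⟩
  rintro v' ⟨h1', h2'⟩
  have := key (b.repr (v' - v)) (by rw [← hb, map_sub, h1', h1, sub_self])
    (fun w ↦ by rw [← hb, map_sub, sub_apply, ← hB, h2', h2, sub_self])
  rw [← sub_eq_zero, hb (v' - v)]
  exact Finset.sum_eq_zero fun i _ ↦ by rw [this, zero_smul]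

theorem reebField_spec (hα : IsContactForm α) (hE : Module.finrank ℝ E = 3) (x : M) :
    α x (reebField α x) = 1 ∧ ∀ w, extDerivOneForm α (reebField α x) w = 0 :=
  Classical.epsilon_spec (existsUnique_reeb hα hE x).exists


variable [RiemannianBundle (fun x : M ↦ TangentSpace I x)]

/-- The Riemannian metric is compatible with the contact structure `ξ`, through the contact form
`α` for `ξ`, the complex structure `J` on `ξ` (extended to `TM` by first projecting along the Reeb
vector field, so that `J` kills the Reeb vector field) and the instantaneous rotation `θ > 0`:
`g(u, v) = (1/θ) dα(u, Jv) + α(u)α(v)`. -/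
structure IsCompatibleMetric (ξ : Π x : M, Submodule ℝ (TangentSpace I x))
    (α : Π x : M, TangentSpace I x →L[ℝ] ℝ)
    (J : Π x : M, TangentSpace I x →L[ℝ] TangentSpace I x) (θ : ℝ) : Prop where
  isContactForm : IsContactForm α
  eq_ker : ∀ (x : M) (v : TangentSpace I x), v ∈ ξ x ↔ α x v = 0
  smooth_J : IsSmoothEndomorphism J
  J_mem : ∀ (x : M), ∀ v ∈ ξ x, J x v ∈ ξ x
  J_J : ∀ (x : M), ∀ v ∈ ξ x, J x (J x v) = -v
  J_reeb : ∀ x : M, J x (reebField α x) = 0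
  rotation_pos : 0 < θ
  inner_eq : ∀ (x : M) (u v : TangentSpace I x),
    inner ℝ u v = 1 / θ * extDerivOneForm α u (J x v) + α x u * α x v

end Contact

/-!
Write `X` for the Reeb field and `A u = ∇_u X`. Compatibility makes `X` the metric dual of `α`,
hence smooth of length one, and `dα` the skew-symmetric part of `A`; therefore `∇_X X = 0` (so flow
lines of `X` are geodesics), `A` takes values in `ξ`, and for a unit vector `e ∈ ξ` the matrix of
`A` on `ξ` in the orthonormal basis `(e, Je)` satisfies `g(Je, Ae) - g(e, AJe) = dα(e, Je) = θ`
(`IsCompatibleMetric.inner_leviCivita_J`). Its trace vanishes, because the Reeb flow preserves `α`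
(`IsCompatibleMetric.inner_leviCivita_add_inner_J`, from the Jacobi identity for `X`, `e`, `Je`).
So `A` on `ξ` is determined by the two numbers `P = g(e, Ae)` and `b = g(Je, Ae) = θ/2 - Q`.

*Ricci curvature.* Since `∇_X X = 0`, the curvature is `R(S, X)X = -∇_X ∇_S X - ∇_[S, X] X`
(`riemannCurvature_geodesic`). Its trace is `-X(tr A) - tr A² = -tr A² = 2 det A`, that is,
`-2P² - 2b(b - θ) = -2P² + θ²/2 - 2Q²` (`IsCompatibleMetric.ricciCurvature_reeb`), which also gives
the upper bound. The second fundamental form of `ξ` is `∓g(v, Au)`, so its determinant is `det A`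
(`IsCompatibleMetric.extrinsicCurvature_eq`), and the bracket formulas for `P` and `Q` follow from
`[e, X] = Ae - ∇_X e` (`IsCompatibleMetric.inner_leviCivita_eq_extDeriv`).

*Jacobi fields.* In a coordinate frame `S`, the equation `D_t v = ∇_v X` along a flow line of `X` is
a linear equation `c' = B c` for the coefficients of `v`, with `B` given by the brackets `[S i, X]`
(`covariantDerivAlong_eq_iff`). As `∇_X X = 0`, its solutions satisfy the second-order Jacobi
equation (`jacobi_equation_of_deriv_eq`), so existence and uniqueness of `α`-Jacobi fields reduce to
those for linear equations. Finally `g(v, Av)/g(v, v) = g(v, D_t v)/g(v, v)`, and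
the Jacobi equation yields its derivative `|Ae|² - g(R(e, X)X, e) - 2 g(e, Ae)²` at `0`
(`IsJacobiFieldOf.hasDerivAt_inner_normalized`), where `|Ae|² = g(e, Ae)² + g(Je, Ae)²`.
-/

/-! ### Germs of smooth functions and vector fields -/

noncomputable section SmoothGerms

variable {E : Type*} [NormedAddCommGroup E] [NormedSpace ℝ E]
  {H : Type*} [TopologicalSpace H] {I : ModelWithCorners ℝ E H}
  {M : Type*} [TopologicalSpace M] [ChartedSpace H M]

variable (I) in
/-- The function `f` is smooth on a neighbourhood of `p`. (Being `C^∞` at the single point `p` is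
weaker: the neighbourhoods on which `f` is `C^n` may shrink to `p` as `n` grows.) -/
def SmoothFunNear (f : M → ℝ) (p : M) : Prop :=
  ∀ᶠ y in 𝓝 p, ContMDiffAt I 𝓘(ℝ, ℝ) ∞ f y

namespace SmoothFunNear
variable {f g : M → ℝ} {p : M}

theorem mdifferentiableAt (hf : SmoothFunNear I f p) : MDiffAt f p :=
  hf.self_of_nhds.mdifferentiableAt (by simp)

theorem eventually (hf : SmoothFunNear I f p) : ∀ᶠ y in 𝓝 p, SmoothFunNear I f y :=
  eventually_eventually_nhds.2 hf

theorem const (c : ℝ) : SmoothFunNear I (fun _ : M ↦ c) p := .of_forall fun _ ↦ contMDiffAt_const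

theorem add (hf : SmoothFunNear I f p) (hg : SmoothFunNear I g p) :
    SmoothFunNear I (fun y ↦ f y + g y) p := by
  filter_upwards [hf, hg] with y h1 h2 using h1.add h2

theorem mul (hf : SmoothFunNear I f p) (hg : SmoothFunNear I g p) :
    SmoothFunNear I (fun y ↦ f y * g y) p := by
  filter_upwards [hf, hg] with y h1 h2 using h1.mul h2

theorem sub (hf : SmoothFunNear I f p) (hg : SmoothFunNear I g p) :
    SmoothFunNear I (fun y ↦ f y - g y) p := by
  filter_upwards [hf, hg] with y h1 h2 using h1.sub h2

theorem congr (hf : SmoothFunNear I f p) (hg : g =ᶠ[𝓝 p] f) : SmoothFunNear I g p := by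
  filter_upwards [hf, hg.eventuallyEq_nhds] with y h1 h2 using h1.congr_of_eventuallyEq h2

theorem sum {ι : Type*} {s : Finset ι} {f : ι → M → ℝ} (hf : ∀ i ∈ s, SmoothFunNear I (f i) p) :
    SmoothFunNear I (fun y ↦ ∑ i ∈ s, f i y) p := by
  have := (Filter.eventually_all_finset s).2 hf
  filter_upwards [this] with y h1
  exact contMDiffAt_finsetSum h1

theorem prod {ι : Type*} {s : Finset ι} {f : ι → M → ℝ} (hf : ∀ i ∈ s, SmoothFunNear I (f i) p) :
    SmoothFunNear I (fun y ↦ ∏ i ∈ s, f i y) p := by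
  have := (Filter.eventually_all_finset s).2 hf
  filter_upwards [this] with y h1
  exact contMDiffAt_finsetProd h1

theorem inv (hf : SmoothFunNear I f p) (h : f p ≠ 0) : SmoothFunNear I (fun y ↦ (f y)⁻¹) p := by
  filter_upwards [hf, hf.mdifferentiableAt.continuousAt.eventually_ne h] with y h1 h2
  exact h1.inv₀ h2

theorem sqrt (hf : SmoothFunNear I f p) (h : f p ≠ 0) : SmoothFunNear I (fun y ↦ √(f y)) p := by
  filter_upwards [hf, hf.mdifferentiableAt.continuousAt.eventually_ne h] with y h1 h2
  exact (contMDiffAt_iff_contDiffAt.2 (Real.contDiffAt_sqrt h2)).comp y h1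

theorem det {ι : Type*} [Fintype ι] [DecidableEq ι] {f : M → Matrix ι ι ℝ}
    (hf : ∀ i j, SmoothFunNear I (fun y ↦ f y i j) p) :
    SmoothFunNear I (fun y ↦ (f y).det) p := by
  simp only [Matrix.det_apply']
  exact sum fun σ _ ↦ (const _).mul (prod fun i _ ↦ hf _ _)

theorem matrix_inv {ι : Type*} [Fintype ι] [DecidableEq ι] {f : M → Matrix ι ι ℝ}
    (hf : ∀ i j, SmoothFunNear I (fun y ↦ f y i j) p) (h : (f p).det ≠ 0) (i j : ι) :
    SmoothFunNear I (fun y ↦ (f y)⁻¹ i j) p := by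
  simp only [Matrix.inv_def, Ring.inverse_eq_inv', Matrix.smul_apply, smul_eq_mul,
    Matrix.adjugate_apply]
  refine ((det hf).inv h).mul (det fun k l ↦ ?_)
  simp only [Matrix.updateRow_apply]
  split_ifs
  · exact const _
  · exact hf _ _

end SmoothFunNear

theorem mvfderiv_congr {f g : M → ℝ} {p : M} (h : f =ᶠ[𝓝 p] g) : d% f p = d% g p :=
  h.mfderiv_eq

variable [IsManifold I ∞ M]

/-- The vector field `X` is smooth on a neighbourhood of `p` (not only at `p`, see
`SmoothFunNear`). -/
def SmoothFieldNear (X : Π x : M, TangentSpace I x) (p : M) : Prop :=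
  ∀ᶠ y in 𝓝 p, ContMDiffAt I I.tangent ∞ (T% X) y

namespace SmoothFieldNear
variable {X Y : Π x : M, TangentSpace I x} {f : M → ℝ} {p : M}

theorem contMDiffAt (hX : SmoothFieldNear X p) : CMDiffAt ∞ (T% X) p := hX.self_of_nhds

theorem mdifferentiableAt (hX : SmoothFieldNear X p) : MDiffAt (T% X) p :=
  hX.self_of_nhds.mdifferentiableAt (by simp)

theorem eventually (hX : SmoothFieldNear X p) : ∀ᶠ y in 𝓝 p, SmoothFieldNear X y :=
  eventually_eventually_nhds.2 hX

theorem congr (hX : SmoothFieldNear X p) (h : ∀ᶠ y in 𝓝 p, Y y = X y) : SmoothFieldNear Y p := by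
  filter_upwards [hX, eventually_eventually_nhds.2 h] with y h1 h2
  exact h1.congr_of_eventuallyEq (h2.mono fun z hz ↦ by simp [hz])

theorem add (hX : SmoothFieldNear X p) (hY : SmoothFieldNear Y p) : SmoothFieldNear (X + Y) p := by
  filter_upwards [hX, hY] with y h1 h2 using h1.add_section h2

theorem sub (hX : SmoothFieldNear X p) (hY : SmoothFieldNear Y p) : SmoothFieldNear (X - Y) p := by
  filter_upwards [hX, hY] with y h1 h2 using h1.sub_section h2

theorem smul (hX : SmoothFieldNear X p) (hf : SmoothFunNear I f p) :
    SmoothFieldNear (f • X) p := by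
  filter_upwards [hf, hX] with y h1 h2 using h1.smul_section h2

theorem sum {ι : Type*} {s : Finset ι} {S : ι → Π x : M, TangentSpace I x}
    (hS : ∀ i ∈ s, SmoothFieldNear (S i) p) : SmoothFieldNear (∑ i ∈ s, S i) p := by
  have := (Filter.eventually_all_finset s).2 hS
  filter_upwards [this] with y h1
  simpa using ContMDiffAt.sum_section h1

theorem extend (v : TangentSpace I p) : SmoothFieldNear (extend E v) p := by
  obtain ⟨s, hs, h⟩ := exists_contMDiffOn_extend (k := ∞) I E v
  filter_upwards [eventually_mem_nhds_iff.2 hs] with y hy using h.contMDiffAt hy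

theorem mlieBracket [CompleteSpace E] (hX : SmoothFieldNear X p) (hY : SmoothFieldNear Y p) :
    SmoothFieldNear (mlieBracket I X Y) p := by
  have : IsManifold I (minSmoothness ℝ 2) M := by
    rw [minSmoothness_of_isRCLikeNormedField]; infer_instance
  have : IsManifold I (((⊤ : ℕ∞) : WithTop ℕ∞) + 1) M := inferInstanceAs (IsManifold I ∞ M)
  filter_upwards [hX, hY] with y h1 h2
  refine ContMDiffAt.mlieBracket_vectorField (m := ⊤) (n := ⊤) h1 h2 ?_
  simp [minSmoothness_of_isRCLikeNormedField]

end SmoothFieldNear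

theorem SmoothFunNear.mvfderiv_apply {X : Π x : M, TangentSpace I x} {f : M → ℝ} {p : M}
    (hf : SmoothFunNear I f p) (hX : SmoothFieldNear X p) :
    SmoothFunNear I (fun y ↦ d% f y (X y)) p := by
  filter_upwards [hf, hX] with y h1 h2
  have h3 := (h1.mfderiv_const (m := ∞) (by simp)).clm_apply_of_inCoordinates h2 h1
  exact (contMDiff_snd_tangentBundle_modelSpace ℝ 𝓘(ℝ, ℝ)).contMDiffAt.comp y h3

theorem IsSmoothOneForm.smoothFunNear {α : Π x : M, TangentSpace I x →L[ℝ] ℝ}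
    (hα : IsSmoothOneForm α) {X : Π x : M, TangentSpace I x} {p : M} (hX : SmoothFieldNear X p) :
    SmoothFunNear I (fun y ↦ α y (X y)) p := by
  filter_upwards [hX] with y h2
  have := ContMDiffAt.clm_bundle_apply (F₁ := E) (F₂ := ℝ) (E₁ := fun x : M ↦ TangentSpace I x)
    (E₂ := Bundle.Trivial M ℝ) (b := fun y : M ↦ y) (ϕ := α) (v := X) (hα y) h2
  rw [contMDiffAt_totalSpace] at this
  exact this.2

theorem IsSmoothEndomorphism.smoothFieldNear {J : Π x : M, TangentSpace I x →L[ℝ] TangentSpace I x}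
    (hJ : IsSmoothEndomorphism J) {X : Π x : M, TangentSpace I x} {p : M}
    (hX : SmoothFieldNear X p) : SmoothFieldNear (fun y ↦ J y (X y)) p := by
  filter_upwards [hX] with y h2
  exact ContMDiffAt.clm_bundle_apply (F₁ := E) (F₂ := E) (E₁ := fun x : M ↦ TangentSpace I x)
    (E₂ := fun x : M ↦ TangentSpace I x) (b := fun y : M ↦ y) (ϕ := J) (v := X) (hJ y) h2

section Frame
variable {p q : M}

variable (I) in
/-- The open set on which `coordFrame I p` is a frame. -/
def frameSet (p : M) : Set M := (trivializationAt E (TangentSpace I) p).baseSet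

theorem frameSet_mem_nhds (hq : q ∈ frameSet I p) : frameSet I p ∈ 𝓝 q :=
  (trivializationAt E (TangentSpace I) p).open_baseSet.mem_nhds hq

theorem mem_frameSet : p ∈ frameSet I p := FiberBundle.mem_baseSet_trivializationAt' p

variable [FiniteDimensional ℝ E]

variable (I) in
/-- The coordinate vector fields of the preferred trivialization of the tangent bundle at `p`. -/
def coordFrame (p : M) (i : Fin (Module.finrank ℝ E)) (x : M) : TangentSpace I x :=
  (trivializationAt E (TangentSpace I) p).localFrame (Module.finBasis ℝ E) i x

variable (I) in
/-- The coefficients of tangent vectors in the frame `coordFrame I p`. -/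
def coordCoeff (p : M) (i : Fin (Module.finrank ℝ E)) (x : M) : TangentSpace I x →ₗ[ℝ] ℝ :=
  (trivializationAt E (TangentSpace I) p).localFrameCoeff I (Module.finBasis ℝ E) i x

theorem smoothFieldNear_coordFrame (hq : q ∈ frameSet I p) (i : Fin (Module.finrank ℝ E)) :
    SmoothFieldNear (coordFrame I p i) q := by
  filter_upwards [frameSet_mem_nhds hq] with y hy
  exact contMDiffAt_localFrame_of_mem _ _ _ i hy

theorem sum_coordCoeff (hq : q ∈ frameSet I p) (v : TangentSpace I q) :
    ∑ i, coordCoeff I p i q v • coordFrame I p i q = v := by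
  have := Trivialization.eq_sum_localFrameCoeff_smul (I := I) (b := Module.finBasis ℝ E)
    (e := trivializationAt E (TangentSpace I) p) (s := FiberBundle.extend E v) hq
  rw [extend_apply_self] at this
  exact this.symm

theorem linearIndependent_coordFrame (hq : q ∈ frameSet I p) :
    LinearIndependent ℝ fun i ↦ coordFrame I p i q :=
  (Trivialization.isLocalFrameOn_localFrame_baseSet I 1 (trivializationAt E (TangentSpace I) p)
    (Module.finBasis ℝ E)).linearIndependent hq

theorem smoothFunNear_coordCoeff (hq : q ∈ frameSet I p) {X : Π x : M, TangentSpace I x}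
    (hX : SmoothFieldNear X q) (i : Fin (Module.finrank ℝ E)) :
    SmoothFunNear I (fun y ↦ coordCoeff I p i y (X y)) q := by
  filter_upwards [frameSet_mem_nhds hq, hX] with y hy h
  exact contMDiffAt_localFrameCoeff (I := I) (Module.finBasis ℝ E) hy h i

end Frame

theorem det_gram_ne_zero {ι V : Type*} [Fintype ι] [DecidableEq ι] [NormedAddCommGroup V]
    [InnerProductSpace ℝ V] {s : ι → V} (hs : LinearIndependent ℝ s) :
    (Matrix.gram ℝ s).det ≠ 0 :=
  (Matrix.posDef_gram_of_linearIndependent hs).det_pos.ne'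

/-- The coefficients of a combination of linearly independent vectors are recovered from its inner
products with these vectors by the inverse of the Gram matrix. -/
theorem sum_inner_mul_inv_gram {ι V : Type*} [Fintype ι] [DecidableEq ι] [NormedAddCommGroup V]
    [InnerProductSpace ℝ V] {s : ι → V} (hs : LinearIndependent ℝ s) (c : ι → ℝ) (i : ι) :
    ∑ j, inner ℝ (∑ k, c k • s k) (s j) * (Matrix.gram ℝ s)⁻¹ j i = c i := by
  have h1 : (fun j ↦ inner ℝ (∑ k, c k • s k) (s j)) = Matrix.vecMul c (Matrix.gram ℝ s) := by
    ext j
    simp [Matrix.vecMul, dotProduct, sum_inner, real_inner_smul_left]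
  change Matrix.vecMul (fun j ↦ inner ℝ (∑ k, c k • s k) (s j)) (Matrix.gram ℝ s)⁻¹ i = c i
  rw [h1, Matrix.vecMul_vecMul,
    Matrix.mul_nonsing_inv _ (isUnit_iff_ne_zero.2 (det_gram_ne_zero hs)), Matrix.vecMul_one]

section Riemannian
variable [RiemannianBundle (fun x : M ↦ TangentSpace I x)]
  {X Y Z : Π x : M, TangentSpace I x} {p : M}

theorem SmoothFieldNear.inner [IsContMDiffRiemannianBundle I ∞ E (fun x : M ↦ TangentSpace I x)]
    (hX : SmoothFieldNear X p) (hY : SmoothFieldNear Y p) :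
    SmoothFunNear I (fun y ↦ inner ℝ (X y) (Y y)) p := by
  filter_upwards [hX, hY] with y h1 h2
  exact ContMDiffAt.inner_bundle (IB := I) (F := E) (E := fun x : M ↦ TangentSpace I x)
    (b := fun y ↦ y) h1 h2

variable [FiniteDimensional ℝ E]

theorem sum_inner_coordFrame {q : M} (hq : q ∈ frameSet I p) (v : TangentSpace I q) :
    ∑ i, (∑ j, inner ℝ v (coordFrame I p j q) *
      (Matrix.gram ℝ fun i ↦ coordFrame I p i q)⁻¹ j i) • coordFrame I p i q = v := by
  have h1 : LinearIndependent ℝ fun i ↦ coordFrame I p i q := linearIndependent_coordFrame hq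
  have h2 := sum_inner_mul_inv_gram (V := TangentSpace I q) (s := fun i ↦ coordFrame I p i q)
    h1 (fun i ↦ coordCoeff I p i q v)
  conv_rhs => rw [← sum_coordCoeff hq v]
  refine Finset.sum_congr rfl fun i _ ↦ ?_
  congr 1
  simpa only [sum_coordCoeff hq v] using h2 i

theorem det_gram_coordFrame_ne_zero {q : M} (hq : q ∈ frameSet I p) :
    (Matrix.gram ℝ fun i ↦ coordFrame I p i q).det ≠ 0 := by
  have h1 : LinearIndependent ℝ fun i ↦ coordFrame I p i q := linearIndependent_coordFrame hq
  exact det_gram_ne_zero (V := TangentSpace I q) h1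

variable [IsContMDiffRiemannianBundle I ∞ E (fun x : M ↦ TangentSpace I x)]

/-- A vector field whose metric dual is smooth is smooth: its coefficients in a frame are obtained
by applying the inverse of the Gram matrix. -/
theorem smoothFieldNear_of_inner
    (h : ∀ Z : Π x : M, TangentSpace I x, SmoothFieldNear Z p →
      SmoothFunNear I (fun y ↦ inner ℝ (Y y) (Z y)) p) : SmoothFieldNear Y p := by
  have hS := fun i ↦ smoothFieldNear_coordFrame (I := I) (mem_frameSet (p := p)) i
  have hd : (Matrix.gram ℝ fun i ↦ coordFrame I p i p).det ≠ 0 :=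
    det_gram_coordFrame_ne_zero mem_frameSet
  have hinv : ∀ i j, SmoothFunNear I
      (fun y ↦ (Matrix.gram ℝ fun i ↦ coordFrame I p i y)⁻¹ i j) p :=
    SmoothFunNear.matrix_inv (fun i j ↦ (hS i).inner (hS j)) hd
  have h0 : ∀ i, SmoothFunNear I (fun y ↦ ∑ j, inner ℝ (Y y) (coordFrame I p j y) *
      (Matrix.gram ℝ fun i ↦ coordFrame I p i y)⁻¹ j i) p := fun i ↦
    .sum fun j _ ↦ (h _ (hS j)).mul (hinv j i)
  have h1 : SmoothFieldNear (∑ i, (fun y ↦ ∑ j, inner ℝ (Y y) (coordFrame I p j y) *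
      (Matrix.gram ℝ fun i ↦ coordFrame I p i y)⁻¹ j i) • coordFrame I p i) p :=
    .sum fun i _ ↦ (hS i).smul (h0 i)
  refine h1.congr ?_
  refine Filter.mem_of_superset (frameSet_mem_nhds (I := I) (mem_frameSet (p := p))) fun y hy ↦ ?_
  change Y y = _
  rw [Finset.sum_apply]
  exact (sum_inner_coordFrame hy (Y y)).symm

/-- `∇_X Y` is smooth, since its metric dual is half of the Koszul expression. -/
theorem SmoothFieldNear.leviCivita (hX : SmoothFieldNear X p) (hY : SmoothFieldNear Y p) :
    SmoothFieldNear (fun y ↦ leviCivita I M Y y (X y)) p := by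
  have : CompleteSpace E := FiniteDimensional.complete ℝ E
  refine smoothFieldNear_of_inner fun Z hZ ↦ ?_
  have h : SmoothFunNear I (fun y ↦ 2⁻¹ * koszul X Y Z y) p := by
    refine (SmoothFunNear.const _).mul ?_
    exact ((((((hY.inner hZ).mvfderiv_apply hX).add ((hX.inner hZ).mvfderiv_apply hY)).sub
      ((hX.inner hY).mvfderiv_apply hZ)).add ((hX.mlieBracket hY).inner hZ)).sub
      ((hX.mlieBracket hZ).inner hY)).sub ((hY.mlieBracket hZ).inner hX)
  refine h.congr ?_
  filter_upwards [hX.eventually, hY.eventually, hZ.eventually] with y h1 h2 h3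
  exact inner_leviCivitaFun h1.mdifferentiableAt h2.mdifferentiableAt h3.mdifferentiableAt

end Riemannian

end SmoothGerms

/-! ### Calculus of the Levi-Civita connection and its curvature -/

noncomputable section LeviCivitaCalculus

variable {E : Type*} [NormedAddCommGroup E] [NormedSpace ℝ E] [FiniteDimensional ℝ E]
  {H : Type*} [TopologicalSpace H] {I : ModelWithCorners ℝ E H}
  {M : Type*} [TopologicalSpace M] [ChartedSpace H M] [IsManifold I ∞ M]
  {S U V W X Y Z : Π x : M, TangentSpace I x} {f : M → ℝ} {p : M}

theorem mlieBracket_leibniz (hU : SmoothFieldNear U p) (hV : SmoothFieldNear V p)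
    (hW : SmoothFieldNear W p) :
    mlieBracket I U (mlieBracket I V W) p =
      mlieBracket I (mlieBracket I U V) W p + mlieBracket I V (mlieBracket I U W) p := by
  have : CompleteSpace E := FiniteDimensional.complete ℝ E
  have : IsManifold I (minSmoothness ℝ 3) M := by
    rw [minSmoothness_of_isRCLikeNormedField]
    exact .of_le (n := ∞) ENat.LEInfty.out
  have hle : minSmoothness ℝ 2 ≤ ∞ := by
    rw [minSmoothness_of_isRCLikeNormedField]
    exact ENat.LEInfty.out
  exact leibniz_identity_mlieBracket_apply (hU.contMDiffAt.of_le hle) (hV.contMDiffAt.of_le hle)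
    (hW.contMDiffAt.of_le hle)

/-- The Lie bracket is the commutator of derivations. This follows by applying the Jacobi identity
to `U`, `V` and `f Z`, where `Z` is any vector field with `Z p ≠ 0`. -/
theorem mvfderiv_mlieBracket (hU : SmoothFieldNear U p) (hV : SmoothFieldNear V p)
    (hf : SmoothFunNear I f p) :
    d% f p (mlieBracket I U V p)
      = d% (fun y ↦ d% f y (V y)) p (U p) - d% (fun y ↦ d% f y (U y)) p (V p) := by
  have : CompleteSpace E := FiniteDimensional.complete ℝ E
  -- if the tangent space is zero, both sides vanish
  rcases subsingleton_or_nontrivial (TangentSpace I p) with h0 | h0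
  · rw [Subsingleton.elim (mlieBracket I U V p) 0, Subsingleton.elim (U p) 0,
      Subsingleton.elim (V p) 0]
    simp
  obtain ⟨z, hz⟩ := exists_ne (0 : TangentSpace I p)
  have hZ := SmoothFieldNear.extend z
  set Z := extend E z
  have key : ∀ {A B : Π x : M, TangentSpace I x}, SmoothFieldNear A p → SmoothFieldNear B p →
      mlieBracket I A (mlieBracket I B (f • Z)) p =
        d% (fun y ↦ d% f y (B y)) p (A p) • z + d% f p (B p) • mlieBracket I A Z p
        + (d% f p (A p) • mlieBracket I B Z p
          + f p • mlieBracket I A (mlieBracket I B Z) p) := by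
    intro A B hA hB
    have h1 : ∀ᶠ y in 𝓝 p, mlieBracket I B (f • Z) y
        = ((fun y ↦ d% f y (B y)) • Z + f • mlieBracket I B Z) y := by
      filter_upwards [hf.eventually, hZ.eventually] with y h2 h3
      simpa using mlieBracket_smul_right (V := B) h2.mdifferentiableAt h3.mdifferentiableAt
    have hd := hf.mvfderiv_apply hB
    rw [(Filter.EventuallyEq.refl (𝓝 p) A).mlieBracket_vectorField_eq h1,
      mlieBracket_add_right (hZ.smul hd).mdifferentiableAt
        ((hB.mlieBracket hZ).smul hf).mdifferentiableAt,
      mlieBracket_smul_right hd.mdifferentiableAt hZ.mdifferentiableAt,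
      mlieBracket_smul_right hf.mdifferentiableAt (hB.mlieBracket hZ).mdifferentiableAt]
    simp [Z]
  have hJ := mlieBracket_leibniz hU hV (hZ.smul hf)
  rw [key hU hV, key hV hU, mlieBracket_smul_right hf.mdifferentiableAt hZ.mdifferentiableAt,
    mlieBracket_leibniz hU hV hZ] at hJ
  have h : (d% (fun y ↦ d% f y (V y)) p (U p) - d% (fun y ↦ d% f y (U y)) p (V p)
      - d% f p (mlieBracket I U V p)) • Z p = 0 := by
    rw [show Z p = z from extend_apply_self E z] at hJ ⊢
    linear_combination (norm := module) hJ
  rw [show Z p = z from extend_apply_self E z] at h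
  linarith [(smul_eq_zero.1 h).resolve_right hz]

/-- A map on smooth germs of vector fields at `p` that is linear over germs of smooth functions
depends only on the value at `p`. -/
theorem eq_of_smooth_tensorial {A : Type*} [AddCommGroup A] [Module ℝ A]
    {Φ : (Π x : M, TangentSpace I x) → A}
    (hadd : ∀ X Y, SmoothFieldNear X p → SmoothFieldNear Y p → Φ (X + Y) = Φ X + Φ Y)
    (hsmul : ∀ (f : M → ℝ) X, SmoothFunNear I f p → SmoothFieldNear X p → Φ (f • X) = f p • Φ X)
    (hcongr : ∀ X Y, SmoothFieldNear X p → SmoothFieldNear Y p → (∀ᶠ y in 𝓝 p, X y = Y y) →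
      Φ X = Φ Y)
    (hX : SmoothFieldNear X p) (hY : SmoothFieldNear Y p) (h : X p = Y p) : Φ X = Φ Y := by
  classical
  have hS := fun i ↦ smoothFieldNear_coordFrame (I := I) (mem_frameSet (p := p)) i
  have hzero : Φ 0 = 0 := by
    have := hsmul (fun _ ↦ 0) X (.const 0) hX
    rwa [zero_smul, show (fun _ : M ↦ (0 : ℝ)) • X = 0 by ext; simp] at this
  have hsum : ∀ (s : Finset (Fin (Module.finrank ℝ E))) (T : Fin (Module.finrank ℝ E) →
      Π x : M, TangentSpace I x), (∀ i, SmoothFieldNear (T i) p) →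
      Φ (∑ i ∈ s, T i) = ∑ i ∈ s, Φ (T i) := by
    intro s T hT
    induction s using Finset.induction_on with
    | empty => simpa using hzero
    | insert i s hi ih =>
      rw [Finset.sum_insert hi, Finset.sum_insert hi, hadd _ _ (hT i) (.sum fun j _ ↦ hT j), ih]
  have key : ∀ X, SmoothFieldNear X p →
      Φ X = ∑ i, coordCoeff I p i p (X p) • Φ (coordFrame I p i) := by
    intro X hX
    have hc := fun i ↦ smoothFunNear_coordCoeff (mem_frameSet (p := p)) hX i
    have h1 : ∀ i, SmoothFieldNear ((fun y ↦ coordCoeff I p i y (X y)) • coordFrame I p i) p :=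
      fun i ↦ (hS i).smul (hc i)
    rw [hcongr X _ hX (.sum fun i _ ↦ h1 i), hsum _ _ h1]
    · exact Finset.sum_congr rfl fun i _ ↦ hsmul _ _ (hc i) (hS i)
    · refine Filter.mem_of_superset (frameSet_mem_nhds (I := I) (mem_frameSet (p := p)))
        fun y hy ↦ ?_
      change X y = _
      rw [Finset.sum_apply]
      exact (sum_coordCoeff hy (X y)).symm
  rw [key X hX, key Y hY, h]

section Connection
variable [RiemannianBundle (fun x : M ↦ TangentSpace I x)]
  [IsContMDiffRiemannianBundle I ∞ E (fun x : M ↦ TangentSpace I x)]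

/-- The covariant derivative `∇_X Y` of vector fields for the Levi-Civita connection, again as a
vector field. -/
def cov (X Y : Π x : M, TangentSpace I x) (x : M) : TangentSpace I x := leviCivita I M Y x (X x)

theorem SmoothFieldNear.cov (hX : SmoothFieldNear X p) (hY : SmoothFieldNear Y p) :
    SmoothFieldNear (cov X Y) p := hX.leviCivita hY

theorem cov_add_left : cov (X + Y) Z p = cov X Z p + cov Y Z p := map_add _ _ _

theorem cov_smul_left : cov (f • X) Z p = f p • cov X Z p := map_smul _ _ _

theorem cov_congr_left (h : X p = Y p) : cov X Z p = cov Y Z p := congrArg _ h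

theorem leviCivita_congr (hX : MDiffAt (T% X) p) (hY : MDiffAt (T% Y) p)
    (h : ∀ᶠ y in 𝓝 p, X y = Y y) : leviCivita I M X p = leviCivita I M Y p :=
  isCovariantDerivativeOn_leviCivitaFun.congr_of_eventuallyEq hX hY Filter.univ_mem h

theorem cov_congr_right (hX : SmoothFieldNear X p) (hY : SmoothFieldNear Y p)
    (h : ∀ᶠ y in 𝓝 p, X y = Y y) : cov Z X p = cov Z Y p :=
  DFunLike.congr_fun (leviCivita_congr hX.mdifferentiableAt hY.mdifferentiableAt h) _

theorem cov_add_right (hX : SmoothFieldNear X p) (hY : SmoothFieldNear Y p) :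
    cov Z (X + Y) p = cov Z X p + cov Z Y p :=
  DFunLike.congr_fun (isCovariantDerivativeOn_leviCivitaFun.add hX.mdifferentiableAt
    hY.mdifferentiableAt) _

theorem cov_smul_right (hf : SmoothFunNear I f p) (hX : SmoothFieldNear X p) :
    cov Z (f • X) p = f p • cov Z X p + d% f p (Z p) • X p :=
  DFunLike.congr_fun (isCovariantDerivativeOn_leviCivitaFun.leibniz hX.mdifferentiableAt
    hf.mdifferentiableAt) _

theorem cov_sub_cov (hX : SmoothFieldNear X p) (hY : SmoothFieldNear Y p) :
    cov X Y p - cov Y X p = mlieBracket I X Y p :=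
  (leviCivita I M).torsion_eq_zero_iff.1 leviCivita_torsion hX.mdifferentiableAt
    hY.mdifferentiableAt

theorem mvfderiv_inner (hY : SmoothFieldNear Y p) (hZ : SmoothFieldNear Z p) :
    d% (fun y ↦ inner ℝ (Y y) (Z y)) p (X p)
      = inner ℝ (cov X Y p) (Z p) + inner ℝ (Y p) (cov X Z p) := by
  have h := leviCivita_metric (mdifferentiableAt_extend I E (X p)) hY.mdifferentiableAt
    hZ.mdifferentiableAt
  rwa [extend_apply_self] at h

/-- The curvature operator `R(U, V)W` on vector fields. -/
def curvField (U V W : Π x : M, TangentSpace I x) (x : M) : TangentSpace I x :=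
  cov U (cov V W) x - cov V (cov U W) x - cov (mlieBracket I U V) W x

theorem curvField_swap : curvField U V W p = - curvField V U W p := by
  have h : cov (mlieBracket I V U) W p = - cov (mlieBracket I U V) W p := by
    rw [cov, mlieBracket_swap_apply, map_neg, cov]
  rw [curvField, curvField, h]
  abel

theorem curvField_add_left (hU : SmoothFieldNear U p) (hS : SmoothFieldNear S p)
    (hW : SmoothFieldNear W p) :
    curvField (U + S) V W p = curvField U V W p + curvField S V W p := by
  have : CompleteSpace E := FiniteDimensional.complete ℝ E
  have h1 : cov V (cov (U + S) W) p = cov V (cov U W) p + cov V (cov S W) p := by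
    rw [← cov_add_right (hU.cov hW) (hS.cov hW)]
    exact cov_congr_right ((hU.add hS).cov hW) ((hU.cov hW).add (hS.cov hW))
      (.of_forall fun y ↦ cov_add_left)
  have h2 : cov (mlieBracket I (U + S) V) W p
      = cov (mlieBracket I U V) W p + cov (mlieBracket I S V) W p := by
    rw [← cov_add_left]
    exact cov_congr_left (mlieBracket_add_left hU.mdifferentiableAt hS.mdifferentiableAt)
  simp only [curvField, h1, h2, cov_add_left]
  abel

theorem curvField_smul_left (hf : SmoothFunNear I f p) (hU : SmoothFieldNear U p)
    (hW : SmoothFieldNear W p) : curvField (f • U) V W p = f p • curvField U V W p := by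
  have : CompleteSpace E := FiniteDimensional.complete ℝ E
  have h1 : cov V (cov (f • U) W) p = f p • cov V (cov U W) p + d% f p (V p) • cov U W p := by
    rw [← cov_smul_right hf (hU.cov hW)]
    exact cov_congr_right ((hU.smul hf).cov hW) ((hU.cov hW).smul hf)
      (.of_forall fun y ↦ cov_smul_left)
  have h2 : cov (mlieBracket I (f • U) V) W p
      = f p • cov (mlieBracket I U V) W p - d% f p (V p) • cov U W p := by
    rw [cov, mlieBracket_smul_left hf.mdifferentiableAt hU.mdifferentiableAt, map_add, map_smul,
      map_smul, cov, cov]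
    module
  simp only [curvField, h1, h2, cov_smul_left]
  module

theorem curvField_congr_left {U' : Π x : M, TangentSpace I x} (hU : SmoothFieldNear U p)
    (hU' : SmoothFieldNear U' p) (hW : SmoothFieldNear W p)
    (h : U p = U' p) : curvField U V W p = curvField U' V W p := by
  refine eq_of_smooth_tensorial (Φ := fun U ↦ curvField U V W p)
    (fun X Y hX hY ↦ curvField_add_left hX hY hW)
    (fun f X hf hX ↦ curvField_smul_left hf hX hW) ?_ hU hU' h
  intro X Y hX hY hXY
  have h1 : cov V (cov X W) p = cov V (cov Y W) p :=
    cov_congr_right (hX.cov hW) (hY.cov hW) (hXY.mono fun y hy ↦ cov_congr_left hy)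
  have h2 : mlieBracket I X V p = mlieBracket I Y V p :=
    Filter.EventuallyEq.mlieBracket_vectorField_eq hXY (.refl _ V)
  simp only [curvField, h1, cov_congr_left h2, cov_congr_left hXY.self_of_nhds]

/-- `R(U, V)W` is tensorial in `W`: the second derivatives of a factor `f` cancel because the Lie
bracket is the commutator of derivations. -/
theorem curvField_congr_right {W' : Π x : M, TangentSpace I x} (hU : SmoothFieldNear U p)
    (hV : SmoothFieldNear V p) (hW : SmoothFieldNear W p) (hW' : SmoothFieldNear W' p)
    (h : W p = W' p) : curvField U V W p = curvField U V W' p := by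
  have : CompleteSpace E := FiniteDimensional.complete ℝ E
  refine eq_of_smooth_tensorial (Φ := fun W ↦ curvField U V W p) ?_ ?_ ?_ hW hW' h
  · intro X Y hX hY
    have h1 : ∀ {A B : Π x : M, TangentSpace I x}, SmoothFieldNear A p → SmoothFieldNear B p →
        cov A (cov B (X + Y)) p = cov A (cov B X) p + cov A (cov B Y) p := by
      intro A B hA hB
      rw [← cov_add_right (hB.cov hX) (hB.cov hY)]
      refine cov_congr_right (hB.cov (hX.add hY)) ((hB.cov hX).add (hB.cov hY)) ?_
      filter_upwards [hX.eventually, hY.eventually] with y h1 h2 using cov_add_right h1 h2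
    simp only [curvField, h1 hU hV, h1 hV hU, cov_add_right hX hY]
    abel
  · intro f X hf hX
    have h1 : ∀ {A B : Π x : M, TangentSpace I x}, SmoothFieldNear A p → SmoothFieldNear B p →
        cov A (cov B (f • X)) p = f p • cov A (cov B X) p + d% f p (A p) • cov B X p
          + (d% f p (B p) • cov A X p + d% (fun y ↦ d% f y (B y)) p (A p) • X p) := by
      intro A B hA hB
      have h2 := hf.mvfderiv_apply hB
      rw [← cov_smul_right hf (hB.cov hX), ← cov_smul_right h2 hX,
        ← cov_add_right ((hB.cov hX).smul hf) (hX.smul h2)]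
      refine cov_congr_right (hB.cov (hX.smul hf)) (((hB.cov hX).smul hf).add (hX.smul h2)) ?_
      filter_upwards [hX.eventually, hf.eventually] with y h1 h2 using cov_smul_right h2 h1
    simp only [curvField, h1 hU hV, h1 hV hU, cov_smul_right hf hX, mvfderiv_mlieBracket hU hV hf]
    module
  · intro X Y hX hY hXY
    have h1 : ∀ {A B : Π x : M, TangentSpace I x}, SmoothFieldNear B p →
        cov A (cov B X) p = cov A (cov B Y) p := by
      intro A B hB
      refine cov_congr_right (hB.cov hX) (hB.cov hY) ?_
      filter_upwards [hX.eventually, hY.eventually, eventually_eventually_nhds.2 hXY]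
        with y h1 h2 h3 using cov_congr_right h1 h2 h3
    simp only [curvField, h1 hV, h1 hU, cov_congr_right hX hY hXY]

/-- The curvature tensor may be computed with any local smooth extensions of the vectors. -/
theorem riemannCurvature_eq (hU : SmoothFieldNear U p) (hV : SmoothFieldNear V p)
    (hW : SmoothFieldNear W p) :
    riemannCurvature (U p) (V p) (W p) = curvField U V W p := by
  have hu := SmoothFieldNear.extend (U p)
  have hv := SmoothFieldNear.extend (V p)
  have hw := SmoothFieldNear.extend (W p)
  have h : riemannCurvature (U p) (V p) (W p)
      = curvField (extend E (U p)) (extend E (V p)) (extend E (W p)) p := by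
    simp only [riemannCurvature, curvField, cov, extend_apply_self]
    rfl
  rw [h, curvField_congr_right hu hv hw hW (extend_apply_self E _),
    curvField_congr_left hu hU hW (extend_apply_self E _), curvField_swap,
    curvField_congr_left hv hV hW (extend_apply_self E _), ← curvField_swap]

variable (I) in
/-- The Jacobi operator `u ↦ R(u, w)w`, as a linear map. -/
def jacobiOperator (w : TangentSpace I p) : TangentSpace I p →ₗ[ℝ] TangentSpace I p where
  toFun u := riemannCurvature u w w
  map_add' u u' := by
    have hu := SmoothFieldNear.extend u
    have hu' := SmoothFieldNear.extend u'
    have hw := SmoothFieldNear.extend w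
    have h := riemannCurvature_eq (hu.add hu') hw hw
    rw [curvField_add_left hu hu' hw, ← riemannCurvature_eq hu hw hw,
      ← riemannCurvature_eq hu' hw hw] at h
    simpa only [Pi.add_apply, extend_apply_self] using h
  map_smul' c u := by
    have hu := SmoothFieldNear.extend u
    have hw := SmoothFieldNear.extend w
    have h := riemannCurvature_eq (hu.smul (.const c)) hw hw
    rw [curvField_smul_left (.const c) hu hw, ← riemannCurvature_eq hu hw hw] at h
    simpa only [Pi.smul_apply', extend_apply_self, RingHom.id_apply] using h

theorem jacobiOperator_apply (u w : TangentSpace I p) :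
    jacobiOperator I w u = riemannCurvature u w w := rfl

/-- For a vector field `X` with geodesic flow lines,
`R(S, X)X = -∇_X ∇_S X - ∇_[S, X] X`. -/
theorem riemannCurvature_geodesic (hS : SmoothFieldNear S p) (hX : SmoothFieldNear X p)
    (hgeo : ∀ᶠ y in 𝓝 p, cov X X y = 0) :
    riemannCurvature (S p) (X p) (X p) = - cov X (cov S X) p - cov (mlieBracket I S X) X p := by
  have h0 : SmoothFieldNear (0 : Π x : M, TangentSpace I x) p := by
    simpa using (SmoothFieldNear.sum (s := ∅) (S := fun _ : ℕ ↦ X) (p := p) (by simp))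
  have h1 : cov S (cov X X) p = 0 := by
    rw [cov_congr_right (hX.cov hX) h0 hgeo, cov, (leviCivita I M).zero]
    rfl
  rw [riemannCurvature_eq hS hX hX, curvField, h1, zero_sub]

end Connection

end LeviCivitaCalculus

/-! ### Vector fields along curves -/

noncomputable section FieldsAlongCurves

theorem hasDerivAt_comp_curve {E : Type*} [NormedAddCommGroup E] [NormedSpace ℝ E]
    {H : Type*} [TopologicalSpace H] {I : ModelWithCorners ℝ E H}
    {M : Type*} [TopologicalSpace M] [ChartedSpace H M] {γ : ℝ → M} {t : ℝ} {f : M → ℝ}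
    (hf : MDiffAt f (γ t)) (hγ : MDifferentiableAt 𝓘(ℝ, ℝ) I γ t) :
    HasDerivAt (fun s ↦ f (γ s)) (d% f (γ t) (mfderiv 𝓘(ℝ, ℝ) I γ t (1 : ℝ))) t := by
  have h := (hf.comp t hγ).differentiableAt.hasDerivAt
  convert! h using 1
  rw [← mvfderiv_comp_apply t hf hγ (1 : ℝ), mvfderiv, mfderiv_eq_fderiv]
  rfl

variable {E : Type*} [NormedAddCommGroup E] [NormedSpace ℝ E] [FiniteDimensional ℝ E]
  {H : Type*} [TopologicalSpace H] {I : ModelWithCorners ℝ E H}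
  {M : Type*} [TopologicalSpace M] [ChartedSpace H M] [IsManifold I ∞ M]
  {p q : M}

theorem coordCoeff_eq_repr (hq : q ∈ frameSet I p) (w : TangentSpace I q)
    (i : Fin (Module.finrank ℝ E)) : coordCoeff I p i q w
      = (Module.finBasis ℝ E).repr (trivializationAt E (TangentSpace I) p ⟨q, w⟩).2 i := by
  have h := Trivialization.localFrameCoeff_apply_of_mem_baseSet (I := I)
    (trivializationAt E (TangentSpace I) p) (Module.finBasis ℝ E) hq (FiberBundle.extend E w) i
  rw [extend_apply_self] at h
  rw [coordCoeff, h]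
  rfl

theorem coordFrame_eq_symm (hq : q ∈ frameSet I p) (i : Fin (Module.finrank ℝ E)) :
    coordFrame I p i q
      = (trivializationAt E (TangentSpace I) p).symm q (Module.finBasis ℝ E i) := by
  rw [coordFrame, Trivialization.localFrame_apply_of_mem_baseSet _ _ hq]
  simp only [Trivialization.basisAt, Module.Basis.map_apply]
  rfl

theorem trivializationAt_symm_eq_sum (hq : q ∈ frameSet I p) (w : E) :
    (trivializationAt E (TangentSpace I) p).symm q w
      = ∑ i, (Module.finBasis ℝ E).repr w i • coordFrame I p i q := by
  have h : ∀ u, (trivializationAt E (TangentSpace I) p).symm q u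
      = ((trivializationAt E (TangentSpace I) p).linearEquivAt ℝ q hq).symm u := fun _ ↦ rfl
  simp only [coordFrame_eq_symm hq, h, ← map_smul, ← map_sum]
  rw [(Module.finBasis ℝ E).sum_repr]

theorem extend_eq_sum_coordFrame (hq : q ∈ frameSet I p) (w : TangentSpace I p) :
    FiberBundle.extend E w q = ∑ i, coordCoeff I p i p w • coordFrame I p i q := by
  simp only [coordCoeff_eq_repr mem_frameSet w]
  exact trivializationAt_symm_eq_sum hq _

variable {t : ℝ}

section Connection
variable [RiemannianBundle (fun x : M ↦ TangentSpace I x)]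
  [IsContMDiffRiemannianBundle I ∞ E (fun x : M ↦ TangentSpace I x)]

theorem leviCivita_sum_smul {ι : Type*} {s : Finset ι} {S : ι → Π x : M, TangentSpace I x}
    {f : ι → M → ℝ} (hS : ∀ i, SmoothFieldNear (S i) p) (hf : ∀ i, SmoothFunNear I (f i) p)
    (w : TangentSpace I p) :
    leviCivita I M (∑ i ∈ s, f i • S i) p w
      = ∑ i ∈ s, (f i p • leviCivita I M (S i) p w + d% (f i) p w • S i p) := by
  classical
  have key : ∀ X : Π x : M, TangentSpace I x, leviCivita I M X p w
      = cov (FiberBundle.extend E w) X p := fun X ↦ by rw [cov, extend_apply_self]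
  induction s using Finset.induction_on with
  | empty => rw [Finset.sum_empty, Finset.sum_empty, (leviCivita I M).zero]; rfl
  | insert i s hi ih =>
    rw [Finset.sum_insert hi, Finset.sum_insert hi, ← ih, key,
      cov_add_right ((hS i).smul (hf i)) (.sum fun j _ ↦ (hS j).smul (hf j)),
      cov_smul_right (hf i) (hS i), ← key, ← key, extend_apply_self]

/-- The defining formula of `covariantDerivAlong`, rewritten in the coordinate frame at the base
point of `v t`. -/
theorem covariantDerivAlong_eq_coordFrame {v : ℝ → TangentBundle I M}
    {c' : Fin (Module.finrank ℝ E) → ℝ} (hγ : ContinuousAt (fun s ↦ (v s).proj) t)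
    (hc : ∀ i, HasDerivAt (fun s ↦ coordCoeff I (v t).proj i (v s).proj (v s).2) (c' i) t) :
    covariantDerivAlong v t = ∑ i, (c' i • coordFrame I (v t).proj i (v t).proj
      + coordCoeff I (v t).proj i (v t).proj (v t).2 •
        leviCivita I M (coordFrame I (v t).proj i) (v t).proj
          (mfderiv 𝓘(ℝ, ℝ) I (fun s ↦ (v s).proj) t (1 : ℝ))) := by
  set x := (v t).proj with hx
  have hS := fun i ↦ smoothFieldNear_coordFrame (I := I) (mem_frameSet (p := x)) i
  have h1 : HasDerivAt (fun s ↦ (trivializationAt E (TangentSpace I) x (v s)).2)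
      (∑ i, c' i • Module.finBasis ℝ E i) t := by
    have h2 : HasDerivAt (fun s ↦ ∑ i, coordCoeff I x i (v s).proj (v s).2 • Module.finBasis ℝ E i)
        (∑ i, c' i • Module.finBasis ℝ E i) t :=
      HasDerivAt.fun_sum fun i _ ↦ (hc i).smul_const _
    refine h2.congr_of_eventuallyEq ?_
    filter_upwards [hγ (frameSet_mem_nhds (I := I) (mem_frameSet (p := x)))] with s hs
    have hs : (v s).proj ∈ frameSet I x := hs
    simp only [coordCoeff_eq_repr hs]
    exact ((Module.finBasis ℝ E).sum_repr _).symm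
  have h3 : leviCivita I M (FiberBundle.extend E (v t).2) x
      = ∑ i, coordCoeff I x i x (v t).2 • leviCivita I M (coordFrame I x i) x := by
    have hsm : ∀ i, SmoothFieldNear ((fun _ ↦ coordCoeff I x i x (v t).2) • coordFrame I x i) x :=
      fun i ↦ (hS i).smul (.const _)
    rw [leviCivita_congr (SmoothFieldNear.extend (v t).2).mdifferentiableAt
      (SmoothFieldNear.sum (s := Finset.univ) fun i _ ↦ hsm i).mdifferentiableAt]
    · ext w
      rw [leviCivita_sum_smul hS fun i ↦ .const _, sum_apply]
      simp [mvfderiv_const]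
    · refine Filter.mem_of_superset (frameSet_mem_nhds (I := I) (mem_frameSet (p := x)))
        fun y hy ↦ ?_
      change FiberBundle.extend E (v t).2 y = _
      rw [Finset.sum_apply]
      exact extend_eq_sum_coordFrame hy _
  rw [covariantDerivAlong, h1.deriv, h3, trivializationAt_symm_eq_sum mem_frameSet]
  rw [Finset.sum_add_distrib, sum_apply]
  congr 1
  refine Finset.sum_congr rfl fun i _ ↦ ?_
  simp [Finsupp.single_apply]
  rfl

/-- If `v = ∑ a_j T_j(γ)` along the curve `γ`, for smooth vector fields `T_j` that need not form a
frame, then `D_t v = ∑ (a_j' T_j(γ) + a_j ∇_{γ'} T_j)`. This frees the covariant derivative along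
curves from the coordinates in which it is defined. -/
theorem covariantDerivAlong_eq {ι : Type*} [Fintype ι] {v : ℝ → TangentBundle I M}
    {T : ι → Π x : M, TangentSpace I x} {a : ι → ℝ → ℝ} {a' : ι → ℝ}
    (hγ : MDifferentiableAt 𝓘(ℝ, ℝ) I (fun s ↦ (v s).proj) t)
    (hT : ∀ j, SmoothFieldNear (T j) (v t).proj) (ha : ∀ j, HasDerivAt (a j) (a' j) t)
    (hv : ∀ᶠ s in 𝓝 t, (v s).2 = ∑ j, a j s • T j (v s).proj) :
    covariantDerivAlong v t = ∑ j, (a' j • T j (v t).proj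
      + a j t • leviCivita I M (T j) (v t).proj
        (mfderiv 𝓘(ℝ, ℝ) I (fun s ↦ (v s).proj) t (1 : ℝ))) := by
  have hS := fun i ↦ smoothFieldNear_coordFrame (I := I) (mem_frameSet (p := (v t).proj)) i
  have hh := fun j i ↦ smoothFunNear_coordCoeff (mem_frameSet (p := (v t).proj)) (hT j) i
  have hc : ∀ i, HasDerivAt (fun s ↦ coordCoeff I (v t).proj i (v s).proj (v s).2)
      (∑ j, (a' j * coordCoeff I (v t).proj i (v t).proj (T j (v t).proj)
        + a j t * d% (fun y ↦ coordCoeff I (v t).proj i y (T j y)) (v t).proj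
          (mfderiv 𝓘(ℝ, ℝ) I (fun s ↦ (v s).proj) t (1 : ℝ)))) t := by
    intro i
    have h1 := HasDerivAt.fun_sum fun j (_ : j ∈ Finset.univ) ↦
      (ha j).mul (hasDerivAt_comp_curve (γ := fun s ↦ (v s).proj) (t := t)
        (hh j i).mdifferentiableAt hγ)
    refine h1.congr_of_eventuallyEq ?_
    filter_upwards [hv] with s hs
    rw [hs, map_sum]
    simp
  have hLC : ∀ j, leviCivita I M (T j) (v t).proj
        (mfderiv 𝓘(ℝ, ℝ) I (fun s ↦ (v s).proj) t (1 : ℝ))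
      = ∑ i, (coordCoeff I (v t).proj i (v t).proj (T j (v t).proj) •
          leviCivita I M (coordFrame I (v t).proj i) (v t).proj
            (mfderiv 𝓘(ℝ, ℝ) I (fun s ↦ (v s).proj) t (1 : ℝ))
        + d% (fun y ↦ coordCoeff I (v t).proj i y (T j y)) (v t).proj
            (mfderiv 𝓘(ℝ, ℝ) I (fun s ↦ (v s).proj) t (1 : ℝ)) •
          coordFrame I (v t).proj i (v t).proj) := by
    intro j
    rw [← leviCivita_sum_smul hS (hh j), leviCivita_congr (hT j).mdifferentiableAt
      (SmoothFieldNear.sum (s := Finset.univ) fun i _ ↦ (hS i).smul (hh j i)).mdifferentiableAt]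
    refine Filter.mem_of_superset (frameSet_mem_nhds (I := I) (mem_frameSet (p := (v t).proj)))
      fun y hy ↦ ?_
    change T j y = _
    rw [Finset.sum_apply]
    exact (sum_coordCoeff hy (T j y)).symm
  have hvt : ∀ i, coordCoeff I (v t).proj i (v t).proj (v t).2
      = ∑ j, a j t * coordCoeff I (v t).proj i (v t).proj (T j (v t).proj) := by
    intro i
    rw [hv.self_of_nhds, map_sum]
    simp
  have hrhs : ∀ j, a' j • T j (v t).proj + a j t • leviCivita I M (T j) (v t).proj
        (mfderiv 𝓘(ℝ, ℝ) I (fun s ↦ (v s).proj) t (1 : ℝ))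
      = ∑ i, ((a' j * coordCoeff I (v t).proj i (v t).proj (T j (v t).proj)
        + a j t * d% (fun y ↦ coordCoeff I (v t).proj i y (T j y)) (v t).proj
          (mfderiv 𝓘(ℝ, ℝ) I (fun s ↦ (v s).proj) t (1 : ℝ))) •
            coordFrame I (v t).proj i (v t).proj
        + (a j t * coordCoeff I (v t).proj i (v t).proj (T j (v t).proj)) •
          leviCivita I M (coordFrame I (v t).proj i) (v t).proj
            (mfderiv 𝓘(ℝ, ℝ) I (fun s ↦ (v s).proj) t (1 : ℝ))) := by
    intro j
    rw [hLC j]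
    nth_rewrite 1 [← sum_coordCoeff mem_frameSet (T j (v t).proj)]
    simp only [Finset.smul_sum, ← Finset.sum_add_distrib]
    refine Finset.sum_congr rfl fun i _ ↦ ?_
    module
  rw [covariantDerivAlong_eq_coordFrame hγ.continuousAt hc,
    Finset.sum_congr rfl fun j _ ↦ hrhs j, Finset.sum_comm]
  refine Finset.sum_congr rfl fun i _ ↦ ?_
  rw [hvt, Finset.sum_smul, Finset.sum_smul, Finset.sum_add_distrib]

end Connection
end FieldsAlongCurves

/-! ### Linear differential equations and integral curves -/

noncomputable section LinearODE

theorem ContDiffAt.succ_of_hasDerivAt {F : Type*} [NormedAddCommGroup F] [NormedSpace ℝ F]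
    {n : ℕ} {u u' : ℝ → F} {t : ℝ} (hu : ∀ᶠ s in 𝓝 t, HasDerivAt u (u' s) s)
    (hu' : ContDiffAt ℝ n u' t) : ContDiffAt ℝ (n + 1) u t := by
  refine contDiffAt_succ_iff_hasFDerivAt.2
    ⟨fun s ↦ ContinuousLinearMap.smulRight (1 : ℝ →L[ℝ] ℝ) (u' s), ⟨_, hu, fun s hs ↦ ?_⟩, ?_⟩
  · exact hs.hasFDerivAt
  · exact contDiffAt_const.smulRight hu'

variable {F : Type*} [NormedAddCommGroup F] [NormedSpace ℝ F] {B : ℝ → F →L[ℝ] F}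

/-- Local existence for the linear equation `c' = B c`. -/
theorem exists_hasDerivAt_linear [CompleteSpace F] (hB : ∀ᶠ t in 𝓝 0, ContinuousAt B t) (c₀ : F) :
    ∃ c : ℝ → F, c 0 = c₀ ∧ ∀ᶠ t in 𝓝 0, HasDerivAt c (B t (c t)) t := by
  obtain ⟨ε, hε, h⟩ := Metric.eventually_nhds_iff_ball.1
    (hB.and (hB.self_of_nhds.norm.eventually_lt_const (lt_add_one ‖B 0‖)))
  set K : ℝ := ‖B 0‖ + 1
  have hK : 0 < K := by positivity
  set L : ℝ := K * (‖c₀‖ + 1)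
  have hL : 0 < L := by positivity
  -- `δ ≤ 1 / L` keeps a solution of speed at most `L` in the unit ball around `c₀`
  set δ : ℝ := min (ε / 2) (1 / L)
  have hδ : 0 < δ := by positivity
  have hmem : ∀ t ∈ Set.Icc (-δ) δ, t ∈ Metric.ball (0 : ℝ) ε := fun t ht ↦ by
    rw [mem_ball_zero_iff, Real.norm_eq_abs]
    have : |t| ≤ δ := abs_le.2 ht
    have : δ ≤ ε / 2 := min_le_left _ _
    linarith
  have hP : IsPicardLindelof (fun t c ↦ B t c) (tmin := -δ) (tmax := δ)
      ⟨0, by simp [hδ.le]⟩ c₀ 1 0 ⟨L, hL.le⟩ ⟨K, hK.le⟩ := by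
    refine ⟨fun t ht ↦ ?_, fun c _ t ht ↦ ?_, fun t ht c hc ↦ ?_, ?_⟩
    · refine ((B t).lipschitz.weaken ?_).lipschitzOnWith
      exact (h t (hmem t ht)).2.le
    · exact ((h t (hmem t ht)).1.clm_apply continuousAt_const).continuousWithinAt
    · refine ((B t).le_opNorm c).trans ?_
      have h1 := (h t (hmem t ht)).2.le
      have h2 : ‖c‖ ≤ ‖c₀‖ + 1 := by
        have := norm_le_norm_add_norm_sub c₀ c
        rw [mem_closedBall_iff_norm] at hc
        simp at hc
        rw [norm_sub_rev] at this
        linarith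
      exact mul_le_mul h1 h2 (norm_nonneg _) hK.le
    · have : δ ≤ 1 / L := min_le_right _ _
      simp only [sub_zero, zero_sub, neg_neg, max_self]
      calc L * δ ≤ L * (1 / L) := by gcongr
        _ = _ := by simp; field_simp
  obtain ⟨c, h1, h2⟩ := hP.exists_eq_forall_mem_Icc_hasDerivWithinAt₀
  refine ⟨c, h1, ?_⟩
  filter_upwards [Ioo_mem_nhds (neg_neg_of_pos hδ) hδ] with t ht
  exact (h2 t (Set.Ioo_subset_Icc_self ht)).hasDerivAt (Icc_mem_nhds ht.1 ht.2)

/-- Local uniqueness for the linear equation `c' = B c`. -/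
theorem eventuallyEq_of_hasDerivAt_linear (hB : ContinuousAt B 0) {c d : ℝ → F}
    (hc : ∀ᶠ t in 𝓝 0, HasDerivAt c (B t (c t)) t) (hd : ∀ᶠ t in 𝓝 0, HasDerivAt d (B t (d t)) t)
    (h : c 0 = d 0) : c =ᶠ[𝓝 0] d := by
  refine ODE_solution_unique_of_eventually (v := fun t c ↦ B t c) (s := fun _ ↦ Set.univ)
    (K := ‖B 0‖₊ + 1) ?_ (hc.mono fun t ht ↦ ⟨ht, trivial⟩) (hd.mono fun t ht ↦ ⟨ht, trivial⟩) h
  filter_upwards [hB.nnnorm.eventually_lt_const (lt_add_one ‖B 0‖₊)] with t ht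
  exact ((B t).lipschitz.weaken ht.le).lipschitzOnWith

theorem contDiffAt_two_of_hasDerivAt_linear {c : ℝ → F} {t : ℝ} (hB : ContDiffAt ℝ 1 B t)
    (hc : ∀ᶠ s in 𝓝 t, HasDerivAt c (B s (c s)) s) : ContDiffAt ℝ 2 c t := by
  have h0 : ContDiffAt ℝ (0 : ℕ) (fun s ↦ B s (c s)) t := by
    obtain ⟨u, hu, h⟩ := Filter.eventually_iff_exists_mem.1
      ((hB.eventually (by simp)).and hc)
    exact contDiffAt_zero.2 ⟨u, hu, fun s hs ↦ ((h s hs).1.continuousAt.clm_apply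
      (h s hs).2.continuousAt).continuousWithinAt⟩
  have h1 : ContDiffAt ℝ (1 : ℕ) c t := ContDiffAt.succ_of_hasDerivAt (n := 0) hc h0
  exact ContDiffAt.succ_of_hasDerivAt (n := 1) hc (hB.clm_apply h1)

end LinearODE

noncomputable section IntegralCurves

variable {E : Type*} [NormedAddCommGroup E] [NormedSpace ℝ E]
  {H : Type*} [TopologicalSpace H] {I : ModelWithCorners ℝ E H}
  {M : Type*} [TopologicalSpace M] [ChartedSpace H M] [IsManifold I ∞ M]

/-- Integral curves of smooth vector fields are `C²`: the velocity `X ∘ γ` is as smooth as `γ`. -/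
theorem IsMIntegralCurveAt.contMDiffAt_two {X : Π x : M, TangentSpace I x} {γ : ℝ → M} {t : ℝ}
    (hγ : IsMIntegralCurveAt γ X t) (hX : SmoothFieldNear X (γ t)) :
    ContMDiffAt 𝓘(ℝ, ℝ) I 2 γ t := by
  have : IsManifold I 1 M := .of_le (n := ∞) ENat.LEInfty.out
  have hphi := hγ.eventually_hasDerivAt
  have hcont : ContinuousAt γ t := hγ.continuousAt
  have hg := (contMDiffAt_section (γ t)).1 hX.contMDiffAt
  have step : ∀ n : ℕ, ContDiffAt ℝ n (extChartAt I (γ t) ∘ γ) t →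
      ContDiffAt ℝ (n + 1) (extChartAt I (γ t) ∘ γ) t := fun n hn ↦ by
    have h1 : ContMDiffAt 𝓘(ℝ, ℝ) I n γ t :=
      contMDiffAt_iff_target.2 ⟨hcont, contMDiffAt_iff_contDiffAt.2 hn⟩
    refine ContDiffAt.succ_of_hasDerivAt hphi ?_
    exact contMDiffAt_iff_contDiffAt.1 ((hg.of_le ENat.LEInfty.out).comp t h1)
  have h0 : ContDiffAt ℝ (0 : ℕ) (extChartAt I (γ t) ∘ γ) t := by
    obtain ⟨u, hu, h⟩ := Filter.eventually_iff_exists_mem.1 hphi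
    exact contDiffAt_zero.2 ⟨u, hu, fun s hs ↦ (h s hs).continuousAt.continuousWithinAt⟩
  exact contMDiffAt_iff_target.2 ⟨hcont, contMDiffAt_iff_contDiffAt.2 (step 1 (step 0 h0))⟩

end IntegralCurves

/-! ### Brackets with a vector field in a coordinate frame -/

noncomputable section JacobiFields

variable {E : Type*} [NormedAddCommGroup E] [NormedSpace ℝ E] [FiniteDimensional ℝ E]
  {H : Type*} [TopologicalSpace H] {I : ModelWithCorners ℝ E H}
  {M : Type*} [TopologicalSpace M] [ChartedSpace H M] [IsManifold I ∞ M]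
  {p q : M}

theorem trivializationAt_sum_coordFrame (hq : q ∈ frameSet I p)
    (c : Fin (Module.finrank ℝ E) → ℝ) :
    (trivializationAt E (TangentSpace I) p
      (⟨q, ∑ i, c i • coordFrame I p i q⟩ : TangentBundle I M)).2
        = ∑ i, c i • Module.finBasis ℝ E i := by
  have h := trivializationAt_symm_eq_sum hq (∑ i, c i • Module.finBasis ℝ E i)
  simp only [map_sum, map_smul, Module.Basis.repr_self, Finsupp.coe_finsetSum, Finset.sum_apply,
    Finsupp.coe_smul, Pi.smul_apply, Finsupp.single_apply, smul_eq_mul, mul_ite, mul_one, mul_zero,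
    Finset.sum_ite_eq', Finset.mem_univ, if_true] at h
  rw [← h, Trivialization.apply_mk_symm _ hq]

theorem coordCoeff_sum_coordFrame (hq : q ∈ frameSet I p)
    (c : Fin (Module.finrank ℝ E) → ℝ) (i : Fin (Module.finrank ℝ E)) :
    coordCoeff I p i q (∑ j, c j • coordFrame I p j q) = c i := by
  rw [coordCoeff_eq_repr hq, trivializationAt_sum_coordFrame hq]
  simp [Finsupp.single_apply]

variable (I) in
/-- The coefficients of the Lie brackets `[S i, X]` in the coordinate frame `S` at `p`. -/
def bracketCoeff (X : Π x : M, TangentSpace I x) (p : M) (k i : Fin (Module.finrank ℝ E)) (y : M) :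
    ℝ :=
  coordCoeff I p k y (mlieBracket I (coordFrame I p i) X y)

variable {X : Π x : M, TangentSpace I x}

theorem sum_bracketCoeff (hq : q ∈ frameSet I p) (i : Fin (Module.finrank ℝ E)) :
    ∑ k, bracketCoeff I X p k i q • coordFrame I p k q = mlieBracket I (coordFrame I p i) X q :=
  sum_coordCoeff hq _

theorem smoothFunNear_bracketCoeff (hq : q ∈ frameSet I p) (hX : SmoothFieldNear X q)
    (k i : Fin (Module.finrank ℝ E)) : SmoothFunNear I (bracketCoeff I X p k i) q := by
  have : CompleteSpace E := FiniteDimensional.complete ℝ E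
  exact smoothFunNear_coordCoeff hq ((smoothFieldNear_coordFrame hq i).mlieBracket hX) k

variable (I) in
/-- The matrix with entries `bracketCoeff I X p k i y`, as a linear map: it sends `c` to the
coefficients of `∑ c i • [S i, X]` in the coordinate frame `S` at `p`. -/
def bracketMap (X : Π x : M, TangentSpace I x) (p y : M) :
    (Fin (Module.finrank ℝ E) → ℝ) →L[ℝ] (Fin (Module.finrank ℝ E) → ℝ) :=
  ∑ k, ∑ i, bracketCoeff I X p k i y •
    (ContinuousLinearMap.proj (R := ℝ) (φ := fun _ ↦ ℝ) i).smulRight (Pi.single k (1 : ℝ))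

theorem bracketMap_apply (y : M) (c : Fin (Module.finrank ℝ E) → ℝ)
    (k : Fin (Module.finrank ℝ E)) :
    bracketMap I X p y c k = ∑ i, bracketCoeff I X p k i y * c i := by
  simp [bracketMap, sum_apply, Finset.sum_apply, Pi.single_apply]

theorem contDiffAt_bracketMap_comp {γ : ℝ → M} {t : ℝ} (hq : γ t ∈ frameSet I p)
    (hX : SmoothFieldNear X (γ t)) (hγ : ContMDiffAt 𝓘(ℝ, ℝ) I 2 γ t) :
    ContDiffAt ℝ 1 (fun s ↦ bracketMap I X p (γ s)) t := by
  refine ContDiffAt.sum fun k _ ↦ ContDiffAt.sum fun i _ ↦ ?_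
  have h := (smoothFunNear_bracketCoeff hq hX k i).self_of_nhds
  have h2 : ContDiffAt ℝ 1 (fun s ↦ bracketCoeff I X p k i (γ s)) t :=
    contMDiffAt_iff_contDiffAt.1 ((h.of_le ENat.LEInfty.out).comp t (hγ.of_le (by norm_num)))
  exact h2.smul contDiffAt_const

theorem differentiableAt_coordCoeff {v : ℝ → TangentBundle I M} {t : ℝ}
    (hq : (v t).proj ∈ frameSet I p)
    (hv : ContMDiffAt 𝓘(ℝ, ℝ) I.tangent 2 v t) :
    DifferentiableAt ℝ (fun s i ↦ coordCoeff I p i (v s).proj (v s).2) t := by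
  refine differentiableAt_pi.2 fun i ↦ ?_
  have h0 : ContinuousAt (fun s ↦ (v s).proj) t :=
    ((contMDiffAt_totalSpace.1 hv).1).continuousAt
  have h := ((trivializationAt E (TangentSpace I) p).contMDiffAt_iff
    ((trivializationAt E (TangentSpace I) p).mem_source.2 hq)).1 hv
  have h2 := (contMDiffAt_iff_contDiffAt.1 h.2).differentiableAt (by norm_num)
  have h3 : DifferentiableAt ℝ (fun s ↦ (Module.finBasis ℝ E).coord i
      (trivializationAt E (TangentSpace I) p (v s)).2) t :=
    ((Module.finBasis ℝ E).coord i).toContinuousLinearMap.differentiableAt.comp t h2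
  refine h3.congr_of_eventuallyEq ?_
  filter_upwards [h0 (frameSet_mem_nhds hq)] with s hs
  exact coordCoeff_eq_repr hs _ i

end JacobiFields

/-! ### The first-order equation of Jacobi fields -/

noncomputable section JacobiFieldsConnection

variable {E : Type*} [NormedAddCommGroup E] [NormedSpace ℝ E] [FiniteDimensional ℝ E]
  {H : Type*} [TopologicalSpace H] {I : ModelWithCorners ℝ E H}
  {M : Type*} [TopologicalSpace M] [ChartedSpace H M] [IsManifold I ∞ M]
  [RiemannianBundle (fun x : M ↦ TangentSpace I x)]
  [IsContMDiffRiemannianBundle I ∞ E (fun x : M ↦ TangentSpace I x)]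
  {X : Π x : M, TangentSpace I x} {p : M} {t : ℝ}

/-- The product rule for the inner product of two vector fields along a curve, given as
combinations of smooth vector fields with differentiable coefficients. -/
theorem hasDerivAt_inner_along {γ : ℝ → M} {V W : Π s, TangentSpace I (γ s)}
    {ι κ : Type*} [Fintype ι] [Fintype κ]
    {T : ι → Π x : M, TangentSpace I x} {a : ι → ℝ → ℝ} {a' : ι → ℝ}
    {U : κ → Π x : M, TangentSpace I x} {b : κ → ℝ → ℝ} {b' : κ → ℝ}
    (hγ : MDifferentiableAt 𝓘(ℝ, ℝ) I γ t)
    (hT : ∀ j, SmoothFieldNear (T j) (γ t)) (ha : ∀ j, HasDerivAt (a j) (a' j) t)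
    (hV : ∀ᶠ s in 𝓝 t, V s = ∑ j, a j s • T j (γ s))
    (hU : ∀ j, SmoothFieldNear (U j) (γ t)) (hb : ∀ j, HasDerivAt (b j) (b' j) t)
    (hW : ∀ᶠ s in 𝓝 t, W s = ∑ j, b j s • U j (γ s)) :
    HasDerivAt (fun s ↦ (inner ℝ (V s) (W s) : ℝ))
      (inner ℝ (covariantDerivAlong (fun s ↦ (⟨γ s, V s⟩ : TangentBundle I M)) t) (W t)
        + inner ℝ (V t) (covariantDerivAlong (fun s ↦ (⟨γ s, W s⟩ : TangentBundle I M)) t)) t := by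
  rw [covariantDerivAlong_eq (v := fun s ↦ (⟨γ s, V s⟩ : TangentBundle I M)) hγ hT ha hV,
    covariantDerivAlong_eq (v := fun s ↦ (⟨γ s, W s⟩ : TangentBundle I M)) hγ hU hb hW]
  have h1 := HasDerivAt.fun_sum fun j (_ : j ∈ Finset.univ) ↦
    HasDerivAt.fun_sum fun k (_ : k ∈ Finset.univ) ↦ ((ha j).mul (hb k)).mul
      (hasDerivAt_comp_curve ((hT j).inner (hU k)).mdifferentiableAt hγ)
  have h2 : ∀ᶠ s in 𝓝 t, (inner ℝ (V s) (W s) : ℝ)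
      = ∑ j, ∑ k, (a j s * b k s) * inner ℝ (T j (γ s)) (U k (γ s)) := by
    filter_upwards [hV, hW] with s h3 h4
    rw [h3, h4]
    simp only [sum_inner]
    simp only [inner_sum, real_inner_smul_left, real_inner_smul_right]
    refine Finset.sum_congr rfl fun j _ ↦ Finset.sum_congr rfl fun k _ ↦ ?_
    ring
  refine (h1.congr_of_eventuallyEq h2).congr_deriv ?_
  rw [hV.self_of_nhds, hW.self_of_nhds]
  simp only [sum_inner]
  simp only [inner_sum, inner_add_left, inner_add_right, real_inner_smul_left,
    real_inner_smul_right]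
  refine Eq.trans (Finset.sum_congr rfl fun j _ ↦ ?_) Finset.sum_add_distrib
  refine Eq.trans (Finset.sum_congr rfl fun k _ ↦ ?_) Finset.sum_add_distrib
  have h5 := leviCivita_metric (mdifferentiableAt_extend I E
    (mfderiv 𝓘(ℝ, ℝ) I γ t (1 : ℝ))) (hT j).mdifferentiableAt (hU k).mdifferentiableAt
  rw [extend_apply_self] at h5
  rw [h5]
  simp only [Pi.mul_apply]
  ring

theorem covariantDerivAlong_eq_cov {ι : Type*} [Fintype ι] {v : ℝ → TangentBundle I M}
    {T : ι → Π x : M, TangentSpace I x} {a : ι → ℝ → ℝ} {a' : ι → ℝ}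
    (hγ : IsMIntegralCurveAt (fun s ↦ (v s).proj) X t)
    (hT : ∀ j, SmoothFieldNear (T j) (v t).proj) (ha : ∀ j, HasDerivAt (a j) (a' j) t)
    (hv : ∀ᶠ s in 𝓝 t, (v s).2 = ∑ j, a j s • T j (v s).proj) :
    covariantDerivAlong v t
      = ∑ j, (a' j • T j (v t).proj + a j t • cov X (T j) (v t).proj) := by
  have hvel : mfderiv 𝓘(ℝ, ℝ) I (fun s ↦ (v s).proj) t (1 : ℝ) = X (v t).proj := by
    rw [hγ.hasMFDerivAt.mfderiv]
    exact one_smul ℝ _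
  refine (covariantDerivAlong_eq hγ.hasMFDerivAt.mdifferentiableAt hT ha hv).trans
    (Finset.sum_congr rfl fun j _ ↦ ?_)
  rw [cov, ← hvel]

theorem leviCivita_eq_sum_coordCoeff {q : M} (hq : q ∈ frameSet I p) (w : TangentSpace I q) :
    leviCivita I M X q w = ∑ i, coordCoeff I p i q w • cov (coordFrame I p i) X q := by
  conv_lhs => rw [← sum_coordCoeff hq w]
  simp only [map_sum, map_smul, cov]

/-- The difference of `D_t v` and `∇_v X` along an integral curve of `X`, in a coordinate
frame `S`: no Christoffel symbols remain, because `∇_X (S i) = ∇_{S i} X - [S i, X]`. -/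
theorem covariantDerivAlong_integralCurve {v : ℝ → TangentBundle I M}
    {c' : Fin (Module.finrank ℝ E) → ℝ} (hX : SmoothFieldNear X (v t).proj)
    (hγ : IsMIntegralCurveAt (fun s ↦ (v s).proj) X t) (hq : (v t).proj ∈ frameSet I p)
    (hc : HasDerivAt (fun s i ↦ coordCoeff I p i (v s).proj (v s).2) c' t) :
    covariantDerivAlong v t = leviCivita I M X (v t).proj (v t).2
      + ∑ k, (c' k - bracketMap I X p (v t).proj
          (fun i ↦ coordCoeff I p i (v t).proj (v t).2) k) • coordFrame I p k (v t).proj := by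
  have hS := fun i ↦ smoothFieldNear_coordFrame hq i
  rw [covariantDerivAlong_eq_cov (T := coordFrame I p) hγ hS (hasDerivAt_pi.1 hc),
    leviCivita_eq_sum_coordCoeff hq]
  · have h1 : ∀ j, cov X (coordFrame I p j) (v t).proj
        = cov (coordFrame I p j) X (v t).proj
          - ∑ k, bracketCoeff I X p k j (v t).proj • coordFrame I p k (v t).proj := fun j ↦ by
      rw [sum_bracketCoeff hq, ← cov_sub_cov (hS j) hX, sub_sub_cancel]
    simp only [h1, bracketMap_apply, sub_smul, smul_sub, Finset.sum_sub_distrib,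
      Finset.sum_add_distrib, Finset.smul_sum, Finset.sum_smul]
    rw [Finset.sum_comm]
    simp only [smul_smul, mul_comm]
    abel
  · filter_upwards [hγ.continuousAt (frameSet_mem_nhds hq)] with s hs
    exact (sum_coordCoeff hs _).symm

/-- Along an integral curve of `X`, the equation `D_t v = ∇_v X` says that the coefficients `c` of
`v` in a coordinate frame satisfy `c' = B c`, where `B` is given by the brackets with `X`. -/
theorem covariantDerivAlong_eq_iff {v : ℝ → TangentBundle I M}
    {c' : Fin (Module.finrank ℝ E) → ℝ} (hX : SmoothFieldNear X (v t).proj)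
    (hγ : IsMIntegralCurveAt (fun s ↦ (v s).proj) X t) (hq : (v t).proj ∈ frameSet I p)
    (hc : HasDerivAt (fun s i ↦ coordCoeff I p i (v s).proj (v s).2) c' t) :
    covariantDerivAlong v t = leviCivita I M X (v t).proj (v t).2 ↔
      c' = bracketMap I X p (v t).proj (fun i ↦ coordCoeff I p i (v t).proj (v t).2) := by
  rw [covariantDerivAlong_integralCurve hX hγ hq hc, add_eq_left]
  refine ⟨fun h ↦ ?_, fun h ↦ by simp [h]⟩
  ext k
  have h2 := Fintype.linearIndependent_iff.1 (linearIndependent_coordFrame hq) _ h k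
  exact sub_eq_zero.1 h2

/-- If the flow lines of `X` are geodesics, then the solutions of `D_t v = ∇_v X` are Jacobi
fields: both `D_t D_t v` and `-R(v, X)X` are the combination of `∇_X ∇_{S i} X` and
`∇_[S i, X] X` with the coefficients of `v`. -/
theorem jacobi_equation_of_deriv_eq {v : ℝ → TangentBundle I M}
    {c : Fin (Module.finrank ℝ E) → ℝ}
    (hX : ∀ q, SmoothFieldNear X q) (hgeo : ∀ q, cov X X q = 0)
    (hγ : IsMIntegralCurveAt (fun s ↦ (v s).proj) X t) (hq : (v t).proj ∈ frameSet I p)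
    (hv : ∀ᶠ s in 𝓝 t, covariantDerivAlong v s = leviCivita I M X (v s).proj (v s).2)
    (hc : HasDerivAt (fun s i ↦ coordCoeff I p i (v s).proj (v s).2) c t) :
    covariantDerivAlong (fun s ↦ (⟨(v s).proj, covariantDerivAlong v s⟩ : TangentBundle I M)) t
      + riemannCurvature (v t).2 (X (v t).proj) (X (v t).proj) = 0 := by
  have hS := fun i ↦ smoothFieldNear_coordFrame hq i
  have hc' := (covariantDerivAlong_eq_iff (hX _) hγ hq hc).1 hv.self_of_nhds
  have h0 : ∀ᶠ s in 𝓝 t, (v s).proj ∈ frameSet I p := hγ.continuousAt (frameSet_mem_nhds hq)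
  have h1 := covariantDerivAlong_eq_cov
    (v := fun s ↦ (⟨(v s).proj, covariantDerivAlong v s⟩ : TangentBundle I M))
    (T := fun i ↦ cov (coordFrame I p i) X) hγ (fun i ↦ (hS i).cov (hX _))
    (hasDerivAt_pi.1 hc) (by
      filter_upwards [hv, h0] with s hs hs0
      exact hs.trans (leviCivita_eq_sum_coordCoeff hs0 _))
  have h2 : riemannCurvature (v t).2 (X (v t).proj) (X (v t).proj)
      = ∑ i, coordCoeff I p i (v t).proj (v t).2 •
        (- cov X (cov (coordFrame I p i) X) (v t).proj
          - cov (mlieBracket I (coordFrame I p i) X) X (v t).proj) := by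
    rw [← jacobiOperator_apply]
    conv_lhs => rw [← sum_coordCoeff hq (v t).2]
    rw [map_sum]
    refine Finset.sum_congr rfl fun i _ ↦ ?_
    rw [map_smul, jacobiOperator_apply,
      riemannCurvature_geodesic (hS i) (hX _) (.of_forall fun y ↦ hgeo y)]
  have h3 : ∀ i, cov (mlieBracket I (coordFrame I p i) X) X (v t).proj
      = ∑ k, bracketCoeff I X p k i (v t).proj • cov (coordFrame I p k) X (v t).proj := fun i ↦ by
    rw [cov, ← sum_bracketCoeff hq]
    simp only [map_sum, map_smul, cov]
  rw [h1, h2, hc']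
  simp only [h3, bracketMap_apply, smul_sub, smul_neg, Finset.sum_sub_distrib,
      Finset.sum_add_distrib, Finset.smul_sum, Finset.sum_smul, Finset.sum_neg_distrib]
  rw [Finset.sum_comm]
  simp only [smul_smul, mul_comm]
  abel

end JacobiFieldsConnection

/-! ### Existence and uniqueness of Jacobi fields -/

noncomputable section JacobiFieldsExistence

variable {E : Type*} [NormedAddCommGroup E] [NormedSpace ℝ E] [FiniteDimensional ℝ E]
  {H : Type*} [TopologicalSpace H] {I : ModelWithCorners ℝ E H}
  {M : Type*} [TopologicalSpace M] [ChartedSpace H M] [IsManifold I ∞ M]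
  [RiemannianBundle (fun x : M ↦ TangentSpace I x)]
  [IsContMDiffRiemannianBundle I ∞ E (fun x : M ↦ TangentSpace I x)]
  {X : Π x : M, TangentSpace I x} {p : M}

/-- Existence of Jacobi fields: solve for the integral curve of `X` through `p`, then solve
`c' = B c` for the coefficients in the coordinate frame at `p`. -/
theorem exists_isJacobiFieldOf [BoundarylessManifold I M] (hX : ∀ q, SmoothFieldNear X q)
    (hgeo : ∀ q, cov X X q = 0) (e : TangentSpace I p) :
    ∃ v : ℝ → TangentBundle I M, IsJacobiFieldOf X v ∧ v 0 = ⟨p, e⟩ := by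
  have : IsManifold I 1 M := .of_le (n := ∞) ENat.LEInfty.out
  have : CompleteSpace E := FiniteDimensional.complete ℝ E
  obtain ⟨γ, rfl, hγ⟩ := exists_isMIntegralCurveAt_of_contMDiffAt_boundaryless 0
    ((hX p).contMDiffAt.of_le ENat.LEInfty.out)
  have hF : ∀ᶠ t in 𝓝 (0 : ℝ), IsMIntegralCurveAt γ X t ∧ γ t ∈ frameSet I (γ 0) :=
    (Filter.Eventually.eventually_nhds hγ).and
      (hγ.continuousAt (frameSet_mem_nhds (I := I) mem_frameSet))
  have hB : ∀ᶠ t in 𝓝 (0 : ℝ), ContDiffAt ℝ 1 (fun s ↦ bracketMap I X (γ 0) (γ s)) t :=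
    hF.mono fun t ht ↦ contDiffAt_bracketMap_comp ht.2 (hX _) (ht.1.contMDiffAt_two (hX _))
  obtain ⟨c, hc0, hc⟩ := exists_hasDerivAt_linear (hB.mono fun t ht ↦ ht.continuousAt)
    (fun i ↦ coordCoeff I (γ 0) i (γ 0) e)
  set v : ℝ → TangentBundle I M := fun t ↦ ⟨γ t, ∑ i, c t i • coordFrame I (γ 0) i (γ t)⟩
  have hcoeff : ∀ t, γ t ∈ frameSet I (γ 0) →
      (fun i ↦ coordCoeff I (γ 0) i (v t).proj (v t).2) = c t := fun t ht ↦
    funext fun i ↦ coordCoeff_sum_coordFrame ht _ i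
  have hderiv : ∀ᶠ t in 𝓝 (0 : ℝ), HasDerivAt
      (fun s i ↦ coordCoeff I (γ 0) i (v s).proj (v s).2)
      (bracketMap I X (γ 0) (γ t) (c t)) t := by
    filter_upwards [hc, hF.eventually_nhds] with t h1 h2
    exact h1.congr_of_eventuallyEq (h2.mono fun s hs ↦ hcoeff s hs.2)
  have hfirst : ∀ᶠ t in 𝓝 (0 : ℝ),
      covariantDerivAlong v t = leviCivita I M X (v t).proj (v t).2 := by
    filter_upwards [hderiv, hF] with t h1 h2
    rw [covariantDerivAlong_eq_iff (hX _) h2.1 h2.2 h1, hcoeff t h2.2]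
  refine ⟨v, ⟨hγ, ?_, ?_, hfirst⟩, ?_⟩
  · filter_upwards [hF, hB, hc.eventually_nhds, hF.eventually_nhds] with t h1 h2 h3 h4
    have hs : v t ∈ (trivializationAt E (TangentSpace I) (γ 0)).source :=
      (trivializationAt E (TangentSpace I) (γ 0)).mem_source.2 h1.2
    rw [(trivializationAt E (TangentSpace I) (γ 0)).contMDiffAt_iff hs]
    refine ⟨h1.1.contMDiffAt_two (hX _), contMDiffAt_iff_contDiffAt.2 ?_⟩
    have h5 : ContDiffAt ℝ 2 (fun s ↦ ∑ i, c s i • Module.finBasis ℝ E i) t :=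
      ContDiffAt.sum fun i _ ↦ (contDiffAt_pi.1
        (contDiffAt_two_of_hasDerivAt_linear h2 h3) i).smul contDiffAt_const
    refine h5.congr_of_eventuallyEq (h4.mono fun s hs ↦ ?_)
    exact trivializationAt_sum_coordFrame hs.2 _
  · filter_upwards [hderiv, hF, hfirst.eventually_nhds] with t h1 h2 h3
    exact jacobi_equation_of_deriv_eq hX hgeo h2.1 h2.2 h3 h1
  · simp only [v, hc0]
    rw [sum_coordCoeff mem_frameSet]

/-- The coefficients of a Jacobi field in the coordinate frame at its initial base point satisfy
`c' = B c`. -/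
theorem IsJacobiFieldOf.eventually_hasDerivAt {v : ℝ → TangentBundle I M}
    (hX : ∀ q, SmoothFieldNear X q) (hv : IsJacobiFieldOf X v) :
    ∀ᶠ t in 𝓝 0, HasDerivAt (fun s i ↦ coordCoeff I (v 0).proj i (v s).proj (v s).2)
      (bracketMap I X (v 0).proj (v t).proj fun i ↦ coordCoeff I (v 0).proj i (v t).proj (v t).2)
      t := by
  filter_upwards [hv.contMDiffAt, hv.deriv_eq, hv.isMIntegralCurveAt.eventually_nhds,
    hv.isMIntegralCurveAt.continuousAt (frameSet_mem_nhds (I := I) mem_frameSet)] with t h1 h2 h3 h4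
  have h5 := (differentiableAt_coordCoeff h4 h1).hasDerivAt
  rwa [(covariantDerivAlong_eq_iff (hX _) h3 h4 h5).1 h2] at h5

/-- Uniqueness of Jacobi fields with given initial value. -/
theorem IsJacobiFieldOf.eventuallyEq [BoundarylessManifold I M] {v w : ℝ → TangentBundle I M}
    (hX : ∀ q, SmoothFieldNear X q) (hv : IsJacobiFieldOf X v) (hw : IsJacobiFieldOf X w)
    (h : v 0 = w 0) : v =ᶠ[𝓝 0] w := by
  have : IsManifold I 1 M := .of_le (n := ∞) ENat.LEInfty.out
  have : CompleteSpace E := FiniteDimensional.complete ℝ E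
  have hbase := isMIntegralCurveAt_eventuallyEq_of_contMDiffAt_boundaryless
    ((hX _).contMDiffAt.of_le ENat.LEInfty.out) hv.isMIntegralCurveAt hw.isMIntegralCurveAt
    (congrArg TotalSpace.proj h)
  have hF : ∀ᶠ t in 𝓝 (0 : ℝ), (v t).proj ∈ frameSet I (v 0).proj :=
    hv.isMIntegralCurveAt.continuousAt (frameSet_mem_nhds (I := I) mem_frameSet)
  have hB : ContinuousAt (fun s ↦ bracketMap I X (v 0).proj (v s).proj) 0 :=
    (contDiffAt_bracketMap_comp mem_frameSet (hX _)
      (hv.isMIntegralCurveAt.contMDiffAt_two (hX _))).continuousAt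
  have hw' := hw.eventually_hasDerivAt hX
  rw [← h] at hw'
  have hc := eventuallyEq_of_hasDerivAt_linear hB (hv.eventually_hasDerivAt hX)
    (d := fun s i ↦ coordCoeff I (v 0).proj i (w s).proj (w s).2) (by
      filter_upwards [hw', hbase] with t h1 h2
      exact (congrArg (bracketMap I X (v 0).proj) h2) ▸ h1) (by rw [h])
  filter_upwards [hc, hbase, hF] with t h1 h2 h3
  have h4 : ∀ i, coordCoeff I (v 0).proj i (v t).proj (v t).2
      = coordCoeff I (v 0).proj i (w t).proj (w t).2 := congrFun h1
  generalize v t = a at h2 h3 h4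
  generalize w t = b at h2 h4
  obtain ⟨x, a⟩ := a
  obtain ⟨y, b⟩ := b
  obtain rfl : x = y := h2
  congr 1
  rw [← sum_coordCoeff h3 a, ← sum_coordCoeff h3 b]
  exact Finset.sum_congr rfl fun i _ ↦ by rw [h4 i]

/-- For a Jacobi field `v`, normalizing `v` turns `g(v, ∇_v X)` into `g(v, D_t v) / g(v, v)`, and
the Jacobi equation gives its derivative. -/
theorem IsJacobiFieldOf.hasDerivAt_inner_normalized {v : ℝ → TangentBundle I M}
    (hX : ∀ q, SmoothFieldNear X q) (hv : IsJacobiFieldOf X v) (hv0 : ‖(v 0).2‖ = 1) :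
    HasDerivAt (fun t ↦ (inner ℝ (‖(v t).2‖⁻¹ • (v t).2)
        (leviCivita I M X (v t).proj (‖(v t).2‖⁻¹ • (v t).2)) : ℝ))
      (‖leviCivita I M X (v 0).proj (v 0).2‖ ^ 2
        - inner ℝ (riemannCurvature (v 0).2 (X (v 0).proj) (X (v 0).proj)) (v 0).2
        - 2 * inner ℝ (v 0).2 (leviCivita I M X (v 0).proj (v 0).2) ^ 2) 0 := by
  have hγ := hv.isMIntegralCurveAt
  have hF : ∀ᶠ t in 𝓝 (0 : ℝ), (v t).proj ∈ frameSet I (v 0).proj :=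
    hγ.continuousAt (frameSet_mem_nhds (I := I) mem_frameSet)
  have hS := fun i ↦ smoothFieldNear_coordFrame (I := I) (mem_frameSet (p := (v 0).proj)) i
  have hc := hasDerivAt_pi.1 (hv.eventually_hasDerivAt hX).self_of_nhds
  have hV : ∀ᶠ s in 𝓝 (0 : ℝ), (v s).2 = ∑ i, coordCoeff I (v 0).proj i (v s).proj (v s).2 •
      coordFrame I (v 0).proj i (v s).proj := hF.mono fun s hs ↦ (sum_coordCoeff hs _).symm
  have hW : ∀ᶠ s in 𝓝 (0 : ℝ), covariantDerivAlong v s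
      = ∑ i, coordCoeff I (v 0).proj i (v s).proj (v s).2 •
        cov (coordFrame I (v 0).proj i) X (v s).proj := by
    filter_upwards [hF, hv.deriv_eq] with s hs hs'
    exact hs'.trans (leviCivita_eq_sum_coordCoeff hs _)
  have h1 := hasDerivAt_inner_along hγ.hasMFDerivAt.mdifferentiableAt hS hc hV hS hc hV
  have h2 := hasDerivAt_inner_along hγ.hasMFDerivAt.mdifferentiableAt hS hc hV
    (fun i ↦ (hS i).cov (hX _)) hc hW
  have hne : (inner ℝ (v 0).2 (v 0).2 : ℝ) ≠ 0 := by simp [hv0]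
  have h3 := h2.div h1 hne
  have h4 := hv.jacobi.self_of_nhds
  have h5 := hv.deriv_eq.self_of_nhds
  refine (h3.congr_of_eventuallyEq ?_).congr_deriv ?_
  · filter_upwards [hv.deriv_eq] with t ht
    simp only [Pi.div_apply]
    rw [map_smul, real_inner_smul_left, real_inner_smul_right, ht, real_inner_self_eq_norm_sq]
    field_simp
  · have h6 := eq_neg_of_add_eq_zero_left h4
    rw [h6]
    change (_ * _ - _ * (inner ℝ (covariantDerivAlong v 0) (v 0).2
      + inner ℝ (v 0).2 (covariantDerivAlong v 0))) / _ = _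
    change ((inner ℝ (covariantDerivAlong v 0) (covariantDerivAlong v 0) + _) * _ - _) / _ = _
    rw [h5, real_inner_self_eq_norm_sq, real_inner_self_eq_norm_sq, hv0, inner_neg_right,
      real_inner_comm (v 0).2 (riemannCurvature _ _ _),
      real_inner_comm (v 0).2 (leviCivita I M X (v 0).proj (v 0).2)]
    ring

end JacobiFieldsExistence

/-! ### Linear algebra of compatible metrics -/

noncomputable section OrthonormalTriples

variable {V : Type*} [NormedAddCommGroup V] [InnerProductSpace ℝ V] {e f n : V}

theorem exists_orthonormalBasis_triple (hV : Module.finrank ℝ V = 3) (he : ‖e‖ = 1) (hf : ‖f‖ = 1)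
    (hn : ‖n‖ = 1) (hef : inner ℝ e f = 0) (hen : inner ℝ e n = 0) (hfn : inner ℝ f n = 0) :
    ∃ b : OrthonormalBasis (Fin 3) ℝ V, b 0 = e ∧ b 1 = f ∧ b 2 = n := by
  have : FiniteDimensional ℝ V := .of_finrank_pos (by omega)
  have ho : Orthonormal ℝ ![e, f, n] := by
    refine ⟨fun i ↦ by fin_cases i <;> simpa, fun i j hij ↦ ?_⟩
    fin_cases i <;> fin_cases j <;> simp_all [real_inner_comm]
  let b := basisOfOrthonormalOfCardEqFinrank ho (by simp [hV])
  have hb : ⇑b = ![e, f, n] := coe_basisOfOrthonormalOfCardEqFinrank ho (by simp [hV])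
  refine ⟨b.toOrthonormalBasis (hb ▸ ho), ?_⟩
  simp [hb]

theorem eq_sum_inner_triple (hV : Module.finrank ℝ V = 3) (he : ‖e‖ = 1) (hf : ‖f‖ = 1)
    (hn : ‖n‖ = 1) (hef : inner ℝ e f = 0) (hen : inner ℝ e n = 0) (hfn : inner ℝ f n = 0) (v : V) :
    v = (inner ℝ e v : ℝ) • e + (inner ℝ f v : ℝ) • f + (inner ℝ n v : ℝ) • n := by
  obtain ⟨b, rfl, rfl, rfl⟩ := exists_orthonormalBasis_triple hV he hf hn hef hen hfn
  have h := b.sum_repr' v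
  rw [Fin.sum_univ_three] at h
  exact h.symm

/-- The trace of an endomorphism may be computed in any orthonormal basis. -/
theorem sum_inner_stdOrthonormalBasis_triple [FiniteDimensional ℝ V] (T : V →ₗ[ℝ] V)
    (hV : Module.finrank ℝ V = 3) (he : ‖e‖ = 1) (hf : ‖f‖ = 1)
    (hn : ‖n‖ = 1) (hef : inner ℝ e f = 0) (hen : inner ℝ e n = 0) (hfn : inner ℝ f n = 0) :
    ∑ i, (inner ℝ (T (stdOrthonormalBasis ℝ V i)) (stdOrthonormalBasis ℝ V i) : ℝ)
      = inner ℝ (T e) e + inner ℝ (T f) f + inner ℝ (T n) n := by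
  obtain ⟨b, rfl, rfl, rfl⟩ := exists_orthonormalBasis_triple hV he hf hn hef hen hfn
  have h1 := T.trace_eq_sum_inner (stdOrthonormalBasis ℝ V)
  have h2 := T.trace_eq_sum_inner b
  rw [Fin.sum_univ_three] at h2
  simp only [real_inner_comm] at h1 h2 ⊢
  rw [← h1, h2]

end OrthonormalTriples

noncomputable section ContactMetric

variable {E : Type*} [NormedAddCommGroup E] [NormedSpace ℝ E]
  {H : Type*} [TopologicalSpace H] {I : ModelWithCorners ℝ E H}
  {M : Type*} [TopologicalSpace M] [ChartedSpace H M] [IsManifold I ∞ M]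
  [RiemannianBundle (fun x : M ↦ TangentSpace I x)]
  {ξ : Π x : M, Submodule ℝ (TangentSpace I x)}
  {α : Π x : M, TangentSpace I x →L[ℝ] ℝ}
  {J : Π x : M, TangentSpace I x →L[ℝ] TangentSpace I x} {θ : ℝ} {x : M}
  {u v n : TangentSpace I x} {U V : Π x : M, TangentSpace I x}

namespace IsCompatibleMetric

theorem extDeriv_J (h : IsCompatibleMetric ξ α J θ) (u : TangentSpace I x) (hv : v ∈ ξ x) :
    extDerivOneForm α u (J x v) = θ * inner ℝ u v := by
  have := h.rotation_pos
  rw [h.inner_eq, (h.eq_ker x v).1 hv]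
  field_simp
  ring

variable [FiniteDimensional ℝ E]

/-- The Reeb field is the metric dual of `α`. -/
theorem inner_reeb (h : IsCompatibleMetric ξ α J θ) (hE : Module.finrank ℝ E = 3)
    (v : TangentSpace I x) : inner ℝ (reebField α x) v = α x v := by
  have h1 := reebField_spec h.isContactForm hE x
  rw [h.inner_eq, h1.1, h1.2]
  ring

theorem norm_reeb (h : IsCompatibleMetric ξ α J θ) (hE : Module.finrank ℝ E = 3) (x : M) :
    ‖reebField α x‖ = 1 := by
  have h1 := real_inner_self_eq_norm_sq (reebField α x)
  rw [h.inner_reeb hE, (reebField_spec h.isContactForm hE x).1] at h1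
  exact (pow_eq_one_iff_of_nonneg (norm_nonneg _) two_ne_zero).1 h1.symm

theorem inner_reeb_of_mem (h : IsCompatibleMetric ξ α J θ) (hE : Module.finrank ℝ E = 3)
    (hu : u ∈ ξ x) : inner ℝ (reebField α x) u = 0 := by
  rw [h.inner_reeb hE, (h.eq_ker x u).1 hu]

theorem extDeriv_of_mem (h : IsCompatibleMetric ξ α J θ) (u : TangentSpace I x) (hv : v ∈ ξ x) :
    extDerivOneForm α u v = -(θ * inner ℝ u (J x v)) := by
  obtain ⟨B, hB⟩ := exists_bilin_extDerivOneForm h.isContactForm.smooth x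
  rw [← h.extDeriv_J u (h.J_mem x v hv), h.J_J x v hv, hB, hB, map_neg, neg_neg]

theorem inner_J_J (h : IsCompatibleMetric ξ α J θ) (hu : u ∈ ξ x) (hv : v ∈ ξ x) :
    inner ℝ (J x u) (J x v) = (inner ℝ u v : ℝ) := by
  have h0 := h.rotation_pos
  have h1 := h.extDeriv_of_mem (J x u) hv
  have h2 := h.extDeriv_J v hu
  rw [extDerivOneForm_swap, h1, real_inner_comm u v, neg_neg] at h2
  exact mul_left_cancel₀ h0.ne' h2

theorem inner_J_self (h : IsCompatibleMetric ξ α J θ) (hu : u ∈ ξ x) :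
    inner ℝ u (J x u) = (0 : ℝ) := by
  have h0 := h.rotation_pos
  have h1 := h.extDeriv_of_mem u hu
  have h2 := extDerivOneForm_swap (α := α) u u
  have h3 : θ * inner ℝ u (J x u) = 0 := by linarith
  exact (mul_eq_zero.1 h3).resolve_left h0.ne'

theorem norm_J (h : IsCompatibleMetric ξ α J θ) (hu : u ∈ ξ x) (hu1 : ‖u‖ = 1) :
    ‖J x u‖ = 1 := by
  have h1 := h.inner_J_J hu hu
  rw [real_inner_self_eq_norm_sq, real_inner_self_eq_norm_sq, hu1] at h1
  exact (pow_eq_one_iff_of_nonneg (norm_nonneg _) two_ne_zero).1 (by simpa using h1)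

theorem eq_sum_inner (h : IsCompatibleMetric ξ α J θ) (hE : Module.finrank ℝ E = 3)
    (hu : u ∈ ξ x) (hu1 : ‖u‖ = 1) (v : TangentSpace I x) :
    v = (inner ℝ u v : ℝ) • u + (inner ℝ (J x u) v : ℝ) • J x u
      + (inner ℝ (reebField α x) v : ℝ) • reebField α x :=
  eq_sum_inner_triple (V := TangentSpace I x) hE hu1 (h.norm_J hu hu1) (h.norm_reeb hE x)
    (h.inner_J_self hu) (by rw [real_inner_comm, h.inner_reeb_of_mem hE hu])
    (by rw [real_inner_comm, h.inner_reeb_of_mem hE (h.J_mem x u hu)]) v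

theorem finrank_eq_two (h : IsCompatibleMetric ξ α J θ) (hE : Module.finrank ℝ E = 3) (x : M) :
    Module.finrank ℝ (ξ x) = 2 := by
  have h0 : (α x).toLinearMap ≠ 0 := fun h0 ↦ by
    have h1 := (reebField_spec h.isContactForm hE x).1
    have h2 : α x (reebField α x) = 0 := LinearMap.congr_fun h0 _
    linarith
  have h1 : ξ x = LinearMap.ker (α x).toLinearMap := by
    ext v
    exact h.eq_ker x v
  have h2 := Module.Dual.finrank_ker_add_one_of_ne_zero h0
  have h3 : Module.finrank ℝ (TangentSpace I x) = 3 := hE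
  rw [h1]
  omega

theorem exists_unit_mem (h : IsCompatibleMetric ξ α J θ) (hE : Module.finrank ℝ E = 3) (x : M) :
    ∃ u ∈ ξ x, ‖u‖ = 1 := by
  have : Nontrivial (ξ x) := Module.nontrivial_of_finrank_pos (R := ℝ)
    (by rw [h.finrank_eq_two hE]; norm_num)
  obtain ⟨u, hu⟩ := exists_norm_eq (ξ x) zero_le_one
  exact ⟨u, u.2, hu⟩

theorem starProjection_eq (h : IsCompatibleMetric ξ α J θ) (hE : Module.finrank ℝ E = 3)
    (v : TangentSpace I x) : (ξ x).starProjection v = v - α x v • reebField α x := by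
  refine Submodule.eq_starProjection_of_mem_of_inner_eq_zero ?_ fun w hw ↦ ?_
  · rw [h.eq_ker]
    simp [(reebField_spec h.isContactForm hE x).1]
  · rw [sub_sub_cancel, real_inner_smul_left, h.inner_reeb_of_mem hE hw, mul_zero]

theorem eq_smul_reeb (h : IsCompatibleMetric ξ α J θ) (hE : Module.finrank ℝ E = 3)
    (hn : ∀ e ∈ ξ x, inner ℝ e n = 0) :
    n = (inner ℝ (reebField α x) n : ℝ) • reebField α x := by
  obtain ⟨e, he, he1⟩ := h.exists_unit_mem hE x
  have h1 := h.eq_sum_inner hE he he1 n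
  rwa [hn e he, hn _ (h.J_mem x e he), zero_smul, zero_smul, zero_add, zero_add] at h1

/-- For sections `U`, `V` of `ξ`, the bracket leaves `ξ` at the rate `α([U, V]) = -dα(U, V)`. -/
theorem apply_mlieBracket_of_mem (h : IsCompatibleMetric ξ α J θ)
    (hU : SmoothFieldNear U x) (hV : SmoothFieldNear V x) (hUξ : ∀ᶠ y in 𝓝 x, U y ∈ ξ y)
    (hVξ : ∀ᶠ y in 𝓝 x, V y ∈ ξ y) :
    α x (mlieBracket I U V x) = - extDerivOneForm α (U x) (V x) := by
  have h1 := extDerivOneForm_apply h.isContactForm.smooth hU.mdifferentiableAt hV.mdifferentiableAt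
  have h2 : ∀ {W : Π x : M, TangentSpace I x} (_ : ∀ᶠ y in 𝓝 x, W y ∈ ξ y)
      (w : TangentSpace I x), d% (fun y ↦ α y (W y)) x w = 0 := fun hW w ↦ by
    rw [mvfderiv_congr (hW.mono fun y hy ↦ (h.eq_ker y _).1 hy), mvfderiv_const]
    rfl
  rw [h2 hUξ, h2 hVξ] at h1
  linarith

end IsCompatibleMetric

end ContactMetric

/-! ### The covariant derivative of the Reeb field -/

noncomputable section ContactCurvature

variable {E : Type*} [NormedAddCommGroup E] [NormedSpace ℝ E] [FiniteDimensional ℝ E]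
  {H : Type*} [TopologicalSpace H] {I : ModelWithCorners ℝ E H}
  {M : Type*} [TopologicalSpace M] [ChartedSpace H M] [IsManifold I ∞ M]
  [RiemannianBundle (fun x : M ↦ TangentSpace I x)]
  [IsContMDiffRiemannianBundle I ∞ E (fun x : M ↦ TangentSpace I x)]
  {ξ : Π x : M, Submodule ℝ (TangentSpace I x)}
  {α : Π x : M, TangentSpace I x →L[ℝ] ℝ}
  {J : Π x : M, TangentSpace I x →L[ℝ] TangentSpace I x} {θ : ℝ} {x : M}
  {e : TangentSpace I x} {U : Π x : M, TangentSpace I x}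

namespace IsCompatibleMetric

theorem smoothFieldNear_reeb (h : IsCompatibleMetric ξ α J θ) (hE : Module.finrank ℝ E = 3)
    (x : M) : SmoothFieldNear (reebField α) x :=
  smoothFieldNear_of_inner fun Z hZ ↦ (h.isContactForm.smooth.smoothFunNear hZ).congr
    (.of_forall fun y ↦ h.inner_reeb hE (Z y))

/-- `dα` is the skew-symmetric part of `∇X`, as `α` is the metric dual of the Reeb field `X`. -/
theorem inner_leviCivita_reeb_sub (h : IsCompatibleMetric ξ α J θ) (hE : Module.finrank ℝ E = 3)
    (u v : TangentSpace I x) :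
    inner ℝ (leviCivita I M (reebField α) x u) v - inner ℝ (leviCivita I M (reebField α) x v) u
      = extDerivOneForm α u v := by
  have hX := h.smoothFieldNear_reeb hE x
  have hU := SmoothFieldNear.extend u
  have hV := SmoothFieldNear.extend v
  have h1 := extDerivOneForm_apply h.isContactForm.smooth hU.mdifferentiableAt hV.mdifferentiableAt
  simp only [← h.inner_reeb hE] at h1
  rw [mvfderiv_inner hX hV, mvfderiv_inner hX hU, ← cov_sub_cov hU hV] at h1
  simp only [cov, inner_sub_right, extend_apply_self] at h1
  linarith

theorem inner_leviCivita_reeb_self (h : IsCompatibleMetric ξ α J θ)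
    (hE : Module.finrank ℝ E = 3) (u : TangentSpace I x) :
    inner ℝ (leviCivita I M (reebField α) x u) (reebField α x) = (0 : ℝ) := by
  have hX := h.smoothFieldNear_reeb hE x
  have h1 := mvfderiv_inner (X := extend E u) hX hX
  simp only [h.inner_reeb hE, (reebField_spec h.isContactForm hE _).1, mvfderiv_const] at h1
  rw [← h.inner_reeb hE, real_inner_comm _ (reebField α x)] at h1
  simp only [cov, extend_apply_self] at h1
  simp only [zero_apply] at h1
  linarith

/-- The flow lines of the Reeb field are geodesics. -/
theorem leviCivita_reeb_reeb (h : IsCompatibleMetric ξ α J θ) (hE : Module.finrank ℝ E = 3)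
    (x : M) : cov (reebField α) (reebField α) x = 0 := by
  refine ext_inner_right ℝ fun v ↦ ?_
  have h1 := h.inner_leviCivita_reeb_sub hE (reebField α x) v
  rw [h.inner_leviCivita_reeb_self hE, (reebField_spec h.isContactForm hE x).2, sub_zero] at h1
  rw [inner_zero_left]
  exact h1

/-- A unit vector of `ξ` extends to a local smooth unit section of `ξ`: project an extension
to `ξ` and normalize. -/
theorem exists_unit_section (h : IsCompatibleMetric ξ α J θ) (hE : Module.finrank ℝ E = 3)
    (he : e ∈ ξ x) (he1 : ‖e‖ = 1) :
    ∃ S : Π x : M, TangentSpace I x, SmoothFieldNear S x ∧ S x = e ∧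
      ∀ᶠ y in 𝓝 x, S y ∈ ξ y ∧ ‖S y‖ = 1 := by
  have hX := h.smoothFieldNear_reeb hE x
  have hW := SmoothFieldNear.extend e
  set Y : Π x : M, TangentSpace I x :=
    extend E e - (fun y ↦ α y (extend E e y)) • reebField α with hYdef
  have hY : SmoothFieldNear Y x := hW.sub (hX.smul (h.isContactForm.smooth.smoothFunNear hW))
  have hYe : Y x = e := by
    simp [hYdef, (h.eq_ker x e).1 he]
  have hYξ : ∀ y, Y y ∈ ξ y := fun y ↦ by
    rw [h.eq_ker]
    simp [hYdef, (reebField_spec h.isContactForm hE y).1]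
  have hn : SmoothFunNear I (fun y ↦ ‖Y y‖) x :=
    ((hY.inner hY).sqrt (by simp [hYe, he1])).congr
      (.of_forall fun y ↦ by simp only [norm_eq_sqrt_real_inner])
  have hn0 : ‖Y x‖ ≠ 0 := by simp [hYe, he1]
  refine ⟨(fun y ↦ ‖Y y‖⁻¹) • Y, hY.smul (hn.inv hn0), ?_, ?_⟩
  · simp [hYe, he1]
  · filter_upwards [hn.mdifferentiableAt.continuousAt.eventually_ne hn0] with y hy
    refine ⟨(ξ y).smul_mem _ (hYξ y), ?_⟩
    rw [Pi.smul_apply', norm_smul, norm_inv, norm_norm, inv_mul_cancel₀ hy]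

/-- The Reeb flow preserves `α`, so `α([X, U]) = X(α(U))`. -/
theorem apply_mlieBracket_reeb (h : IsCompatibleMetric ξ α J θ) (hE : Module.finrank ℝ E = 3)
    (hU : SmoothFieldNear U x) :
    α x (mlieBracket I (reebField α) U x) = d% (fun y ↦ α y (U y)) x (reebField α x) := by
  have h1 := extDerivOneForm_apply h.isContactForm.smooth
    (h.smoothFieldNear_reeb hE x).mdifferentiableAt hU.mdifferentiableAt
  rw [(reebField_spec h.isContactForm hE x).2] at h1
  simp only [(reebField_spec h.isContactForm hE _).1, mvfderiv_const] at h1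
  simp at h1
  linarith

end IsCompatibleMetric

end ContactCurvature

/-! ### Trace of the covariant derivative of the Reeb field -/

noncomputable section ContactCurvature

variable {E : Type*} [NormedAddCommGroup E] [NormedSpace ℝ E] [FiniteDimensional ℝ E]
  {H : Type*} [TopologicalSpace H] {I : ModelWithCorners ℝ E H}
  {M : Type*} [TopologicalSpace M] [ChartedSpace H M] [IsManifold I ∞ M]
  [RiemannianBundle (fun x : M ↦ TangentSpace I x)]
  [IsContMDiffRiemannianBundle I ∞ E (fun x : M ↦ TangentSpace I x)]
  {ξ : Π x : M, Submodule ℝ (TangentSpace I x)}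
  {α : Π x : M, TangentSpace I x →L[ℝ] ℝ}
  {J : Π x : M, TangentSpace I x →L[ℝ] TangentSpace I x} {θ : ℝ} {x : M}
  {e : TangentSpace I x} {U V W : Π x : M, TangentSpace I x}

theorem inner_cov_add_of_inner_const (hU : SmoothFieldNear U x) (hV : SmoothFieldNear V x)
    {c : ℝ} (hc : ∀ᶠ y in 𝓝 x, inner ℝ (U y) (V y) = c) :
    inner ℝ (cov W U x) (V x) + inner ℝ (U x) (cov W V x) = (0 : ℝ) := by
  rw [← mvfderiv_inner hU hV, mvfderiv_congr hc, mvfderiv_const]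
  rfl

theorem inner_cov_self_of_norm_one (hU : SmoothFieldNear U x) (hU1 : ∀ᶠ y in 𝓝 x, ‖U y‖ = 1) :
    inner ℝ (U x) (cov W U x) = (0 : ℝ) := by
  have h := inner_cov_add_of_inner_const (W := W) hU hU (c := 1)
    (hU1.mono fun y hy ↦ by rw [real_inner_self_eq_norm_sq, hy, one_pow])
  rw [real_inner_comm (U x)] at h
  linarith

namespace IsCompatibleMetric

/-- The divergence of the Reeb field vanishes. This comes from the Jacobi identity for the Reeb
field `X`, a unit section `S` of `ξ` and `J S`: the Reeb flow preserves `ξ`, and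
`α([S, J S]) = -θ` is constant. -/
theorem inner_leviCivita_add_inner_J (h : IsCompatibleMetric ξ α J θ)
    (hE : Module.finrank ℝ E = 3) (he : e ∈ ξ x) (he1 : ‖e‖ = 1) :
    inner ℝ e (leviCivita I M (reebField α) x e)
      + inner ℝ (J x e) (leviCivita I M (reebField α) x (J x e)) = (0 : ℝ) := by
  have : CompleteSpace E := FiniteDimensional.complete ℝ E
  obtain ⟨S, hS, rfl, hSξ⟩ := h.exists_unit_section hE he he1
  have hX := h.smoothFieldNear_reeb hE x
  have hT : SmoothFieldNear (fun y ↦ J y (S y)) x := h.smooth_J.smoothFieldNear hS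
  set T : Π x : M, TangentSpace I x := fun y ↦ J y (S y) with hTdef
  have hTξ : ∀ᶠ y in 𝓝 x, T y ∈ ξ y ∧ ‖T y‖ = 1 := hSξ.mono fun y hy ↦
    ⟨h.J_mem y _ hy.1, h.norm_J hy.1 hy.2⟩
  have hmem : ∀ {U : Π x : M, TangentSpace I x}, SmoothFieldNear U x →
      (∀ᶠ y in 𝓝 x, U y ∈ ξ y) → ∀ᶠ y in 𝓝 x, mlieBracket I (reebField α) U y ∈ ξ y := by
    intro U hU hUξ
    filter_upwards [hU.eventually, hUξ.eventually_nhds] with y h1 h2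
    rw [h.eq_ker, h.apply_mlieBracket_reeb hE h1,
      mvfderiv_congr (h2.mono fun z hz ↦ (h.eq_ker z _).1 hz), mvfderiv_const]
    rfl
  have hXS := hmem hS (hSξ.mono fun y hy ↦ hy.1)
  have hXT := hmem hT (hTξ.mono fun y hy ↦ hy.1)
  have h1 := congrArg (α x) (mlieBracket_leibniz hX hS hT)
  have h2 : ∀ᶠ y in 𝓝 x, α y (mlieBracket I S T y) = -θ := by
    filter_upwards [hS.eventually, hT.eventually, hSξ.eventually_nhds, hTξ.eventually_nhds]
      with y h3 h4 h5 h6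
    rw [h.apply_mlieBracket_of_mem h3 h4 (h5.mono fun z hz ↦ hz.1) (h6.mono fun z hz ↦ hz.1),
      h.extDeriv_J _ h5.self_of_nhds.1, real_inner_self_eq_norm_sq, h5.self_of_nhds.2]
    ring
  rw [map_add, h.apply_mlieBracket_reeb hE (hS.mlieBracket hT), mvfderiv_congr h2, mvfderiv_const,
    h.apply_mlieBracket_of_mem (hX.mlieBracket hS) hT hXS (hTξ.mono fun y hy ↦ hy.1),
    h.apply_mlieBracket_of_mem hS (hX.mlieBracket hT) (hSξ.mono fun y hy ↦ hy.1) hXT,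
    extDerivOneForm_swap (S x), h.extDeriv_J _ he, h.extDeriv_of_mem _ he,
    ← cov_sub_cov hX hS, ← cov_sub_cov hX hT, inner_sub_left, inner_sub_left,
    real_inner_comm (S x), real_inner_comm (S x), real_inner_comm (J x (S x)),
    real_inner_comm (J x (S x))] at h1
  have h3 := inner_cov_self_of_norm_one (W := reebField α) hS (hSξ.mono fun y hy ↦ hy.2)
  have h4 := inner_cov_self_of_norm_one (W := reebField α) hT (hTξ.mono fun y hy ↦ hy.2)
  change _ = -(θ * (inner ℝ (S x) (cov (reebField α) S x)
    - inner ℝ (S x) (leviCivita I M (reebField α) x (S x))))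
      + - -(-(θ * (inner ℝ (T x) (cov (reebField α) T x)
        - inner ℝ (T x) (leviCivita I M (reebField α) x (J x (S x)))))) at h1
  rw [h3, h4] at h1
  have h5 : θ * (inner ℝ (S x) (leviCivita I M (reebField α) x (S x))
      + inner ℝ (J x (S x)) (leviCivita I M (reebField α) x (J x (S x)))) = 0 := by
    simp only [zero_apply] at h1
    linarith
  exact (mul_eq_zero.1 h5).resolve_left h.rotation_pos.ne'

/-- The rotation `dα(e, Je) = θ` relates the off-diagonal entries of `∇X` on `ξ`. -/
theorem inner_leviCivita_J (h : IsCompatibleMetric ξ α J θ) (hE : Module.finrank ℝ E = 3)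
    (he : e ∈ ξ x) (he1 : ‖e‖ = 1) :
    inner ℝ e (leviCivita I M (reebField α) x (J x e))
      = (inner ℝ (J x e) (leviCivita I M (reebField α) x e) - θ : ℝ) := by
  have h1 := h.inner_leviCivita_reeb_sub hE e (J x e)
  rw [h.extDeriv_J _ he, real_inner_self_eq_norm_sq, he1, real_inner_comm (J x e),
    real_inner_comm e] at h1
  linarith

theorem leviCivita_reeb_eq (h : IsCompatibleMetric ξ α J θ) (hE : Module.finrank ℝ E = 3)
    (he : e ∈ ξ x) (he1 : ‖e‖ = 1) (u : TangentSpace I x) :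
    leviCivita I M (reebField α) x u = (inner ℝ e (leviCivita I M (reebField α) x u) : ℝ) • e
      + (inner ℝ (J x e) (leviCivita I M (reebField α) x u) : ℝ) • J x e := by
  have h1 := h.eq_sum_inner hE he he1 (leviCivita I M (reebField α) x u)
  rwa [real_inner_comm _ (reebField α x), h.inner_leviCivita_reeb_self hE, zero_smul,
    add_zero] at h1

theorem norm_sq_leviCivita_reeb (h : IsCompatibleMetric ξ α J θ) (hE : Module.finrank ℝ E = 3)
    (he : e ∈ ξ x) (he1 : ‖e‖ = 1) (u : TangentSpace I x) :
    ‖leviCivita I M (reebField α) x u‖ ^ 2 = (inner ℝ e (leviCivita I M (reebField α) x u)) ^ 2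
      + (inner ℝ (J x e) (leviCivita I M (reebField α) x u)) ^ 2 := by
  rw [← real_inner_self_eq_norm_sq]
  nth_rewrite 1 [h.leviCivita_reeb_eq hE he he1 u]
  rw [inner_add_left, real_inner_smul_left, real_inner_smul_left]
  ring

theorem sectionalCurvature_reeb (h : IsCompatibleMetric ξ α J θ) (hE : Module.finrank ℝ E = 3)
    (he : e ∈ ξ x) (he1 : ‖e‖ = 1) : sectionalCurvature e (reebField α x)
      = inner ℝ (riemannCurvature e (reebField α x) (reebField α x)) e := by
  rw [sectionalCurvature, h.norm_reeb hE, he1, real_inner_comm (reebField α x) e,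
    h.inner_reeb_of_mem hE he]
  simp

theorem ricciCurvature_reeb_eq_add (h : IsCompatibleMetric ξ α J θ)
    (hE : Module.finrank ℝ E = 3) (he : e ∈ ξ x) (he1 : ‖e‖ = 1) :
    ricciCurvature (reebField α x) = sectionalCurvature e (reebField α x)
      + sectionalCurvature (J x e) (reebField α x) := by
  have hX := h.smoothFieldNear_reeb hE x
  have h0 : riemannCurvature (reebField α x) (reebField α x) (reebField α x) = 0 := by
    rw [riemannCurvature_eq hX hX hX]
    have h2 : (2 : ℝ) • curvField (reebField α) (reebField α) (reebField α) x = 0 := by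
      rw [two_smul]
      nth_rewrite 1 [curvField_swap]
      exact neg_add_cancel _
    exact (smul_eq_zero.1 h2).resolve_left two_ne_zero
  have h1 := sum_inner_stdOrthonormalBasis_triple (V := TangentSpace I x)
    (jacobiOperator I (reebField α x)) hE he1 (h.norm_J he he1) (h.norm_reeb hE x)
    (h.inner_J_self he) (by rw [real_inner_comm, h.inner_reeb_of_mem hE he])
    (by rw [real_inner_comm, h.inner_reeb_of_mem hE (h.J_mem x e he)])
  rw [h.sectionalCurvature_reeb hE he he1,
    h.sectionalCurvature_reeb hE (h.J_mem x e he) (h.norm_J he he1)]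
  simp only [jacobiOperator_apply, h0, inner_zero_left, add_zero] at h1
  exact h1

end IsCompatibleMetric

end ContactCurvature

/-! ### Ricci curvature of the Reeb field -/

noncomputable section RicciReeb

variable {E : Type*} [NormedAddCommGroup E] [NormedSpace ℝ E] [FiniteDimensional ℝ E]
  {H : Type*} [TopologicalSpace H] {I : ModelWithCorners ℝ E H}
  {M : Type*} [TopologicalSpace M] [ChartedSpace H M] [IsManifold I ∞ M]
  [RiemannianBundle (fun x : M ↦ TangentSpace I x)]
  [IsContMDiffRiemannianBundle I ∞ E (fun x : M ↦ TangentSpace I x)]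
  {ξ : Π x : M, Submodule ℝ (TangentSpace I x)}
  {α : Π x : M, TangentSpace I x →L[ℝ] ℝ}
  {J : Π x : M, TangentSpace I x →L[ℝ] TangentSpace I x} {θ : ℝ} {x : M}
  {e : TangentSpace I x} {S U : Π x : M, TangentSpace I x}

namespace IsCompatibleMetric

/-- As `∇_X X = 0`, covariant differentiation along the Reeb field `X` preserves sections of `ξ`. -/
theorem inner_reeb_cov (h : IsCompatibleMetric ξ α J θ) (hE : Module.finrank ℝ E = 3)
    (hU : SmoothFieldNear U x) (hUξ : ∀ᶠ y in 𝓝 x, U y ∈ ξ y) :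
    inner ℝ (reebField α x) (cov (reebField α) U x) = (0 : ℝ) := by
  have h1 := inner_cov_add_of_inner_const (W := reebField α) (h.smoothFieldNear_reeb hE x) hU
    (hUξ.mono fun y hy ↦ h.inner_reeb_of_mem hE hy)
  rwa [h.leviCivita_reeb_reeb hE, inner_zero_left, zero_add] at h1

theorem inner_riemannCurvature_reeb (h : IsCompatibleMetric ξ α J θ)
    (hE : Module.finrank ℝ E = 3) (hS : SmoothFieldNear S x) :
    inner ℝ (riemannCurvature (S x) (reebField α x) (reebField α x)) (S x)
      = inner ℝ (cov S (reebField α) x) (cov (reebField α) S x)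
        - d% (fun y ↦ inner ℝ (cov S (reebField α) y) (S y)) x (reebField α x)
        - (inner ℝ (leviCivita I M (reebField α) x (mlieBracket I S (reebField α) x))
          (S x) : ℝ) := by
  have hX := h.smoothFieldNear_reeb hE x
  rw [riemannCurvature_geodesic hS hX (.of_forall fun y ↦ h.leviCivita_reeb_reeb hE y),
    mvfderiv_inner (hS.cov hX) hS, inner_sub_left, inner_neg_left]
  simp only [cov]
  ring

/-- Since `R(S, X)X = -(∇_X ∇X) S - (∇X)² S` and the trace of `∇X` is constantly `0`, the Ricci
curvature of the Reeb field `X` is `-tr (∇X)²`, which is computed here from the entries of `∇X` in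
the frame `(e, Je)` of `ξ`. -/
theorem ricciCurvature_reeb (h : IsCompatibleMetric ξ α J θ)
    (hE : Module.finrank ℝ E = 3) (he : e ∈ ξ x) (he1 : ‖e‖ = 1) :
    ricciCurvature (reebField α x) = -2 * inner ℝ e (leviCivita I M (reebField α) x e) ^ 2
      - 2 * inner ℝ (J x e) (leviCivita I M (reebField α) x e)
        * (inner ℝ (J x e) (leviCivita I M (reebField α) x e) - θ) := by
  have hf := h.J_mem x e he
  have hf1 := h.norm_J he he1
  rw [h.ricciCurvature_reeb_eq_add hE he he1, h.sectionalCurvature_reeb hE he he1,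
    h.sectionalCurvature_reeb hE hf hf1]
  have htr := h.inner_leviCivita_add_inner_J hE he he1
  have hbc := h.inner_leviCivita_J hE he he1
  have hAe := h.leviCivita_reeb_eq hE he he1 e
  have hAf := h.leviCivita_reeb_eq hE he he1 (J x e)
  have hef := h.inner_J_self he
  obtain ⟨S, hS, rfl, hSξ⟩ := h.exists_unit_section hE he he1
  have hX := h.smoothFieldNear_reeb hE x
  have hT : SmoothFieldNear (fun y ↦ J y (S y)) x := h.smooth_J.smoothFieldNear hS
  set T : Π x : M, TangentSpace I x := fun y ↦ J y (S y) with hTdef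
  have hTx : J x (S x) = T x := rfl
  have hTξ : ∀ᶠ y in 𝓝 x, T y ∈ ξ y ∧ ‖T y‖ = 1 := hSξ.mono fun y hy ↦
    ⟨h.J_mem y _ hy.1, h.norm_J hy.1 hy.2⟩
  rw [hTx] at hf hf1 htr hbc hAe hAf hef ⊢
  -- the derivative of the trace of `∇X` vanishes
  have hd : d% (fun y ↦ inner ℝ (cov S (reebField α) y) (S y)) x (reebField α x)
      + d% (fun y ↦ inner ℝ (cov T (reebField α) y) (T y)) x (reebField α x) = 0 := by
    have h1 := mvfderiv_fun_add ((hS.cov hX).inner hS).mdifferentiableAt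
      ((hT.cov hX).inner hT).mdifferentiableAt
    rw [← add_apply, ← h1, mvfderiv_congr (g := fun _ ↦ (0 : ℝ)), mvfderiv_const]
    · rfl
    · filter_upwards [hSξ] with y hy
      rw [real_inner_comm (S y), real_inner_comm (T y)]
      exact h.inner_leviCivita_add_inner_J hE hy.1 hy.2
  -- in the frame, `∇_X S = ρ T` and `∇_X T = -ρ S`
  set ρ : ℝ := inner ℝ (T x) (cov (reebField α) S x) with hρ
  have hST : inner ℝ (S x) (cov (reebField α) T x) = -ρ := by
    have h1 := inner_cov_add_of_inner_const (W := reebField α) hS hT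
      (hSξ.mono fun y hy ↦ h.inner_J_self hy.1)
    rw [real_inner_comm (T x)] at h1
    linarith
  have hXS : cov (reebField α) S x = ρ • T x := by
    have h1 := h.eq_sum_inner hE he he1 (cov (reebField α) S x)
    rwa [inner_cov_self_of_norm_one hS (hSξ.mono fun y hy ↦ hy.2),
      h.inner_reeb_cov hE hS (hSξ.mono fun y hy ↦ hy.1), zero_smul, zero_smul, zero_add,
      add_zero] at h1
  have hXT : cov (reebField α) T x = -ρ • S x := by
    have h1 := h.eq_sum_inner hE he he1 (cov (reebField α) T x)
    have h2 := inner_cov_self_of_norm_one (W := reebField α) hT (hTξ.mono fun y hy ↦ hy.2)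
    rwa [hTx, h2, hST, h.inner_reeb_cov hE hT (hTξ.mono fun y hy ↦ hy.1), zero_smul, zero_smul,
      add_zero, add_zero] at h1
  have h1 := h.inner_riemannCurvature_reeb hE hS
  have h2 := h.inner_riemannCurvature_reeb hE hT
  rw [← cov_sub_cov hS hX, hXS, map_sub, map_smul, cov] at h1
  rw [← cov_sub_cov hT hX, hXT, map_sub, map_smul, cov] at h2
  have hSS := real_inner_self_eq_norm_sq (S x)
  have hTT := real_inner_self_eq_norm_sq (T x)
  rw [he1] at hSS
  rw [hf1] at hTT
  set a : ℝ := inner ℝ (S x) (leviCivita I M (reebField α) x (S x))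
  set b : ℝ := inner ℝ (T x) (leviCivita I M (reebField α) x (S x))
  set c : ℝ := inner ℝ (S x) (leviCivita I M (reebField α) x (T x))
  set d : ℝ := inner ℝ (T x) (leviCivita I M (reebField α) x (T x))
  have hTS : inner ℝ (T x) (S x) = (0 : ℝ) := by rw [real_inner_comm, hef]
  rw [h1, h2]
  simp only [hAe, hAf, map_add, map_smul, inner_add_left, inner_sub_left,
    real_inner_smul_left, real_inner_smul_right, hSS, hTT, hTS, hef]
  have hd' : d = -a := by linarith
  rw [hd', hbc]
  linear_combination -hd

end IsCompatibleMetric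

end RicciReeb

/-! ### Extrinsic curvature and brackets with the Reeb field -/

noncomputable section ExtrinsicCurvature

variable {E : Type*} [NormedAddCommGroup E] [NormedSpace ℝ E] [FiniteDimensional ℝ E]
  {H : Type*} [TopologicalSpace H] {I : ModelWithCorners ℝ E H}
  {M : Type*} [TopologicalSpace M] [ChartedSpace H M] [IsManifold I ∞ M]
  [RiemannianBundle (fun x : M ↦ TangentSpace I x)]
  [IsContMDiffRiemannianBundle I ∞ E (fun x : M ↦ TangentSpace I x)]
  {ξ : Π x : M, Submodule ℝ (TangentSpace I x)}
  {α : Π x : M, TangentSpace I x →L[ℝ] ℝ}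
  {J : Π x : M, TangentSpace I x →L[ℝ] TangentSpace I x} {θ : ℝ} {x : M}
  {v n : TangentSpace I x} {S : Π x : M, TangentSpace I x}

namespace IsCompatibleMetric

/-- The second fundamental form of `ξ` is `-⟨v, ∇_u X⟩` up to the sign of `n = ±X`. -/
theorem secondFundamentalForm_eq (h : IsCompatibleMetric ξ α J θ) (hE : Module.finrank ℝ E = 3)
    (hn : ∀ e ∈ ξ x, inner ℝ e n = 0) (u : TangentSpace I x) (hv : v ∈ ξ x) :
    secondFundamentalForm ξ n u v = -(inner ℝ (reebField α x) n
      * inner ℝ v (leviCivita I M (reebField α) x u)) := by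
  have hX := h.smoothFieldNear_reeb hE x
  have hW := SmoothFieldNear.extend v
  have hV : SmoothFieldNear (fun y ↦ (ξ y).starProjection (extend E v y)) x :=
    (hW.sub (hX.smul (h.isContactForm.smooth.smoothFunNear hW))).congr
      (.of_forall fun y ↦ h.starProjection_eq hE _)
  have h1 := inner_cov_add_of_inner_const (W := extend E u) hV hX (c := 0)
    (.of_forall fun y ↦ by
      rw [real_inner_comm, h.inner_reeb_of_mem hE (Submodule.starProjection_apply_mem _ _)])
  simp only [cov, extend_apply_self, h.starProjection_eq hE v, (h.eq_ker x v).1 hv, zero_smul,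
    sub_zero] at h1
  rw [secondFundamentalForm]
  nth_rewrite 1 [h.eq_smul_reeb hE hn]
  rw [real_inner_smul_right]
  linear_combination (inner ℝ (reebField α x) n) * h1

/-- Up to sign, `secondFundamentalForm` is given by `∇X`, so the extrinsic curvature is the
determinant of `∇X` on `ξ`; it is written here in the frame `(e, Je)`, for the first vector `e` of
the orthonormal basis of `ξ` that defines it. -/
theorem extrinsicCurvature_eq (h : IsCompatibleMetric ξ α J θ) (hE : Module.finrank ℝ E = 3)
    (hn1 : ‖n‖ = 1) (hn : ∀ e ∈ ξ x, inner ℝ e n = 0) :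
    ∃ e ∈ ξ x, ‖e‖ = 1 ∧ extrinsicCurvature ξ n
      = -inner ℝ e (leviCivita I M (reebField α) x e) ^ 2
        - inner ℝ (J x e) (leviCivita I M (reebField α) x e)
          * (inner ℝ (J x e) (leviCivita I M (reebField α) x e) - θ) := by
  have hs : (inner ℝ (reebField α x) n : ℝ) ^ 2 = 1 := by
    have h1 := congrArg norm (h.eq_smul_reeb hE hn)
    rw [norm_smul, h.norm_reeb hE, hn1, mul_one, Real.norm_eq_abs] at h1
    rw [← sq_abs, ← h1, one_pow]
  have key : ∀ (m : ℕ) (_ : m = 2) (b : OrthonormalBasis (Fin m) ℝ (ξ x)),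
      ∃ e ∈ ξ x, ‖e‖ = 1 ∧ Matrix.det (Matrix.of fun i j ↦
        secondFundamentalForm ξ n (b i : TangentSpace I x) (b j))
      = -inner ℝ e (leviCivita I M (reebField α) x e) ^ 2
        - inner ℝ (J x e) (leviCivita I M (reebField α) x e)
          * (inner ℝ (J x e) (leviCivita I M (reebField α) x e) - θ) := by
    rintro _ rfl b
    have he : (b 0 : TangentSpace I x) ∈ ξ x := (b 0).2
    have hf : (b 1 : TangentSpace I x) ∈ ξ x := (b 1).2
    have he1 : ‖(b 0 : TangentSpace I x)‖ = 1 := b.norm_eq_one 0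
    have hf1 : ‖(b 1 : TangentSpace I x)‖ = 1 := b.norm_eq_one 1
    have hef : (inner ℝ (b 0 : TangentSpace I x) (b 1 : TangentSpace I x) : ℝ) = 0 :=
      b.inner_eq_zero (by norm_num)
    refine ⟨b 0, he, he1, ?_⟩
    rw [Matrix.det_fin_two]
    simp only [Matrix.of_apply, h.secondFundamentalForm_eq hE hn _ he,
      h.secondFundamentalForm_eq hE hn _ hf]
    -- the second basis vector is `J (b 0)` up to sign
    have h1 := h.eq_sum_inner hE he he1 (b 1)
    rw [hef, h.inner_reeb_of_mem hE hf, zero_smul, zero_smul, zero_add, add_zero] at h1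
    have hs' : (inner ℝ (J x (b 0)) (b 1 : TangentSpace I x) : ℝ) ^ 2 = 1 := by
      have h2 := congrArg norm h1
      rw [norm_smul, h.norm_J he he1, hf1, mul_one, Real.norm_eq_abs] at h2
      rw [← sq_abs, ← h2, one_pow]
    generalize (inner ℝ (J x (b 0)) (b 1 : TangentSpace I x) : ℝ) = s at h1 hs'
    rw [h1]
    simp only [map_smul, real_inner_smul_left, real_inner_smul_right,
      h.inner_leviCivita_J hE he he1]
    have htr := h.inner_leviCivita_add_inner_J hE he he1
    rw [eq_neg_of_add_eq_zero_right htr]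
    generalize (inner ℝ (reebField α x) n : ℝ) = r at hs
    linear_combination (s ^ 2 * (-inner ℝ (b 0 : TangentSpace I x)
      (leviCivita I M (reebField α) x (b 0)) ^ 2
        - inner ℝ (J x (b 0)) (leviCivita I M (reebField α) x (b 0))
          * (inner ℝ (J x (b 0)) (leviCivita I M (reebField α) x (b 0)) - θ))) * hs
      + (-inner ℝ (b 0 : TangentSpace I x) (leviCivita I M (reebField α) x (b 0)) ^ 2
        - inner ℝ (J x (b 0)) (leviCivita I M (reebField α) x (b 0))
          * (inner ℝ (J x (b 0)) (leviCivita I M (reebField α) x (b 0)) - θ)) * hs'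
  exact key _ (h.finrank_eq_two hE x) _

/-- The covariant derivative `∇_e X` in terms of the Lie brackets of a unit section of `ξ` with the
Reeb field. -/
theorem inner_leviCivita_eq_extDeriv (h : IsCompatibleMetric ξ α J θ)
    (hE : Module.finrank ℝ E = 3) (hS : SmoothFieldNear S x)
    (hSξ : ∀ᶠ y in 𝓝 x, S y ∈ ξ y ∧ ‖S y‖ = 1) :
    inner ℝ (S x) (leviCivita I M (reebField α) x (S x))
        = 1 / θ * extDerivOneForm α (mlieBracket I S (reebField α) x) (J x (S x)) ∧
    θ / 2 - inner ℝ (J x (S x)) (leviCivita I M (reebField α) x (S x))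
        = 1 / (2 * θ) * extDerivOneForm α (mlieBracket I S (reebField α) x) (S x)
          - 1 / (2 * θ) * extDerivOneForm α
            (mlieBracket I (fun y ↦ J y (S y)) (reebField α) x) (J x (S x)) := by
  have hθ := h.rotation_pos.ne'
  have hX := h.smoothFieldNear_reeb hE x
  have hT : SmoothFieldNear (fun y ↦ J y (S y)) x := h.smooth_J.smoothFieldNear hS
  have he := hSξ.self_of_nhds.1
  have he1 := hSξ.self_of_nhds.2
  have h1 := inner_cov_self_of_norm_one (W := reebField α) hS (hSξ.mono fun y hy ↦ hy.2)
  have h2 := inner_cov_add_of_inner_const (W := reebField α) hS hT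
    (hSξ.mono fun y hy ↦ h.inner_J_self hy.1)
  have h3 := h.inner_leviCivita_J hE he he1
  rw [← cov_sub_cov hS hX, ← cov_sub_cov hT hX, h.extDeriv_J _ he, h.extDeriv_J _ he,
    h.extDeriv_of_mem _ he]
  have h4 : inner ℝ (cov S (reebField α) x) (S x)
      = (inner ℝ (S x) (leviCivita I M (reebField α) x (S x)) : ℝ) := real_inner_comm _ _
  have h5 : inner ℝ (cov S (reebField α) x) (J x (S x))
      = (inner ℝ (J x (S x)) (leviCivita I M (reebField α) x (S x)) : ℝ) := real_inner_comm _ _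
  have h6 : inner ℝ (cov (fun y ↦ J y (S y)) (reebField α) x) (S x)
      = (inner ℝ (S x) (leviCivita I M (reebField α) x (J x (S x))) : ℝ) := real_inner_comm _ _
  rw [real_inner_comm (cov _ S x) (S x)] at h1
  rw [real_inner_comm (cov _ _ x) (S x)] at h2
  simp only [inner_sub_left, h4, h5, h6, h3, h1, eq_neg_of_add_eq_zero_left h2]
  constructor <;> field_simp <;> ring

end IsCompatibleMetric

end ExtrinsicCurvature

/-! ### Curvature of contact 3-manifolds -/

theorem mainTheorem3 {M : Type*} [TopologicalSpace M] [T2Space M] [SecondCountableTopology M]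
    [ChartedSpace (EuclideanSpace ℝ (Fin 3)) M] [IsManifold (𝓡 3) ∞ M]
    [RiemannianBundle (fun x : M ↦ TangentSpace (𝓡 3) x)]
    [IsContMDiffRiemannianBundle (𝓡 3) ∞ (EuclideanSpace ℝ (Fin 3))
      (fun x : M ↦ TangentSpace (𝓡 3) x)]
    (ξ : Π x : M, Submodule ℝ (TangentSpace (𝓡 3) x))
    (α : Π x : M, TangentSpace (𝓡 3) x →L[ℝ] ℝ)
    (J : Π x : M, TangentSpace (𝓡 3) x →L[ℝ] TangentSpace (𝓡 3) x) (θ : ℝ)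
    (h : IsCompatibleMetric ξ α J θ) (p : M) :
    (∀ e ∈ ξ p, ‖e‖ = 1 →
      (∃ v : ℝ → TangentBundle (𝓡 3) M, IsJacobiFieldOf (reebField α) v ∧ v 0 = ⟨p, e⟩) ∧
      (∀ v w : ℝ → TangentBundle (𝓡 3) M, IsJacobiFieldOf (reebField α) v → v 0 = ⟨p, e⟩ →
        IsJacobiFieldOf (reebField α) w → w 0 = ⟨p, e⟩ → v =ᶠ[𝓝 0] w) ∧
      (∀ v : ℝ → TangentBundle (𝓡 3) M, IsJacobiFieldOf (reebField α) v → v 0 = ⟨p, e⟩ →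
        ∃ d : ℝ,
          HasDerivAt (fun t ↦ inner ℝ (‖(v t).2‖⁻¹ • (v t).2)
            (leviCivita (𝓡 3) M (reebField α) (v t).proj (‖(v t).2‖⁻¹ • (v t).2))) d 0 ∧
          sectionalCurvature e (reebField α p)
            = inner ℝ (J p e) (leviCivita (𝓡 3) M (reebField α) p e) ^ 2
              - inner ℝ e (leviCivita (𝓡 3) M (reebField α) p e) ^ 2 - d) ∧
      ricciCurvature (reebField α p)
        = sectionalCurvature e (reebField α p) + sectionalCurvature (J p e) (reebField α p)) ∧
    (∀ n : TangentSpace (𝓡 3) p, ‖n‖ = 1 → (∀ e ∈ ξ p, inner ℝ e n = 0) →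
      ricciCurvature (reebField α p) = 2 * extrinsicCurvature ξ n) ∧
    (∀ (U : Set M) (e : Π x : M, TangentSpace (𝓡 3) x), IsOpen U → p ∈ U →
      ContMDiffOn (𝓡 3) (𝓡 3).tangent ∞ (fun x ↦ (⟨x, e x⟩ : TangentBundle (𝓡 3) M)) U →
      (∀ x ∈ U, e x ∈ ξ x ∧ ‖e x‖ = 1) →
      ∃ P Q : ℝ,
        P = inner ℝ (e p) (leviCivita (𝓡 3) M (reebField α) p (e p)) ∧
        P = 1 / θ * extDerivOneForm α (mlieBracket (𝓡 3) e (reebField α) p) (J p (e p)) ∧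
        Q = θ / 2 - inner ℝ (J p (e p)) (leviCivita (𝓡 3) M (reebField α) p (e p)) ∧
        Q = 1 / (2 * θ) * extDerivOneForm α (mlieBracket (𝓡 3) e (reebField α) p) (e p)
          - 1 / (2 * θ) * extDerivOneForm α
              (mlieBracket (𝓡 3) (fun x ↦ J x (e x)) (reebField α) p) (J p (e p)) ∧
        ricciCurvature (reebField α p) = -2 * P ^ 2 + θ ^ 2 / 2 - 2 * Q ^ 2) ∧
    ricciCurvature (reebField α p) ≤ θ ^ 2 / 2 := by
  have hE : Module.finrank ℝ (EuclideanSpace ℝ (Fin 3)) = 3 := by simp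
  have hX := h.smoothFieldNear_reeb hE
  have hgeo := h.leviCivita_reeb_reeb hE
  refine ⟨fun e he he1 ↦ ⟨exists_isJacobiFieldOf hX hgeo e, fun v w hv hv0 hw hw0 ↦
    hv.eventuallyEq hX hw (hv0.trans hw0.symm), fun v hv hv0 ↦ ?_,
    h.ricciCurvature_reeb_eq_add hE he he1⟩, fun n hn1 hn ↦ ?_, fun U e hU hp he heξ ↦ ?_, ?_⟩
  · have h1 := hv.hasDerivAt_inner_normalized hX (by rw [hv0]; exact he1)
    rw [hv0] at h1
    refine ⟨_, h1, ?_⟩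
    rw [h.sectionalCurvature_reeb hE he he1, h.norm_sq_leviCivita_reeb hE he he1]
    ring
  · obtain ⟨e, he, he1, hG⟩ := h.extrinsicCurvature_eq hE hn1 hn
    rw [hG, h.ricciCurvature_reeb hE he he1]
    ring
  · have hS : SmoothFieldNear e p := by
      filter_upwards [hU.mem_nhds hp] with y hy using (he y hy).contMDiffAt (hU.mem_nhds hy)
    obtain ⟨h1, h2⟩ := h.inner_leviCivita_eq_extDeriv hE hS
      (by filter_upwards [hU.mem_nhds hp] with y hy using heξ y hy)
    refine ⟨_, _, rfl, h1, rfl, h2, ?_⟩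
    rw [h.ricciCurvature_reeb hE (heξ p hp).1 (heξ p hp).2]
    ring
  · obtain ⟨e, he, he1⟩ := h.exists_unit_mem hE p
    rw [h.ricciCurvature_reeb hE he he1]
    nlinarith [sq_nonneg (inner ℝ e (leviCivita (𝓡 3) M (reebField α) p e) : ℝ),
      sq_nonneg (θ / 2 - inner ℝ (J p e) (leviCivita (𝓡 3) M (reebField α) p e))]
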